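/- Let $m,n\ge 0$ and let $\mu=(\mu_1,\dots,\mu_m\,|\,\mu_{m+1},\dots,\mu_{m+n})$ be a sequence of positive integers (a composition of $(M|N)$, $M=\mu_1+\dots+\mu_m$, $N=\mu_{m+1}+\dots+\mu_{m+n}$). Put $\bar a=0$ for $1\le a\le m$ and $\bar a=1$ for $m+1\le a\le m+n$. Let $\widehat Y_\mu$ be the associative unital superalgebra over $\mathbb C$ with generators $D_{a;i,j}^{(r)}, D_{a;i,j}^{\prime(r)}$ ($1\le a\le m+n$, $1\le i,j\le\mu_a$, $r\ge 0$), $E_{a;i,j}^{(r)}$ ($1\le a<m+n$, $1\le i\le\mu_a$, $1\le j\le \mu_{a+1}$, $r\ge1$), $F_{a;i,j}^{(r)}$ ($1\le a<m+n$, $1\le i\le\mu_{a+1}$, $1\le j\le\mu_a$, $r\ge1$), where $D,D'$ are even, $E_a,F_a$ have parity $\overline{a}+\overline{a+1}$, $[x,y]=xy-(-1)^{|x||y|}yx$, and with the following defining relations for all admissible indices ($r,s,l\ge 1$ for upper indices of $E$ and $F$; repeated $p$, $q$ are summed over $1,\dots,\mu_a$ and $1,\dots,\mu_{a+1}$ respectively):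 \begin{align*} &D_{a;i,j}^{(0)}=\delta_{ij},\qquad \sum_{t=0}^{r}D_{a;i,p}^{(t)}D_{a;p,j}^{\prime(r-t)}=\delta_{r0}\delta_{ij},\\ &[D_{a;i,j}^{(r)},D_{b;h,k}^{(s)}]=\delta_{ab}(-1)^{\bar a}\sum_{t=0}^{\min(r,s)-1}\big(D_{a;h,j}^{(t)}D_{a;i,k}^{(r+s-1-t)}-D_{a;h,j}^{(r+s-1-t)}D_{a;i,k}^{(t)}\big),\\ &[D_{a;i,j}^{(r)},E_{b;h,k}^{(s)}]=\delta_{a,b}\delta_{hj}(-1)^{\bar a}\sum_{t=0}^{r-1}D_{a;i,p}^{(t)}E_{a;p,k}^{(r+s-1-t)}-\delta_{a,b+1}(-1)^{\bar a}\sum_{t=0}^{r-1}D_{a;i,k}^{(t)}E_{b;h,j}^{(r+s-1-t)},\\ &[D_{a;i,j}^{(r)},F_{b;h,k}^{(s)}]=-\delta_{a,b}\delta_{ki}(-1)^{\bar a}\sum_{t=0}^{r-1}F_{b;h,p}^{(r+s-1-t)}D_{a;p,j}^{(t)}+\delta_{a,b+1}(-1)^{\bar a}\sum_{t=0}^{r-1}F_{b;i,k}^{(r+s-1-t)}D_{a;h,j}^{(t)},\\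 &[E_{a;i,j}^{(r)},E_{a;h,k}^{(s)}]=(-1)^{\overline{a+1}}\Big(\sum_{t=1}^{s-1}-\sum_{t=1}^{r-1}\Big)E_{a;i,k}^{(t)}E_{a;h,j}^{(r+s-1-t)},\\ &[F_{a;i,j}^{(r)},F_{a;h,k}^{(s)}]=(-1)^{\overline{a}}\Big(\sum_{t=1}^{r-1}-\sum_{t=1}^{s-1}\Big)F_{a;i,k}^{(r+s-1-t)}F_{a;h,j}^{(t)},\\ &[E_{a;i,j}^{(r)},F_{b;h,k}^{(s)}]=-\delta_{a,b}(-1)^{\overline{b+1}}\sum_{t=0}^{r+s-1}D_{a+1;h,j}^{(r+s-1-t)}D_{a;i,k}^{\prime(t)},\\ &[E_{a;i,j}^{(r+1)},E_{a+1;h,k}^{(s)}]-[E_{a;i,j}^{(r)},E_{a+1;h,k}^{(s+1)}]=(-1)^{\overline{a+1}}\delta_{hj}E_{a;i,q}^{(r)}E_{a+1;q,k}^{(s)},\\ &[F_{a;i,j}^{(r+1)},F_{a+1;h,k}^{(s)}]-[F_{a;i,j}^{(r)},F_{a+1;h,k}^{(s+1)}]=-(-1)^{\overline{a+1}}\delta_{ik}F_{a+1;h,q}^{(s)}F_{a;q,j}^{(r)},\\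 &[E_{a;i,j}^{(r)},E_{b;h,k}^{(s)}]=0\ \text{ if } b>a+1 \text{ or if } b=a+1,\ h\ne j,\qquad [F_{a;i,j}^{(r)},F_{b;h,k}^{(s)}]=0\ \text{ if } b>a+1 \text{ or if } b=a+1,\ i\ne k,\\ &\big[E_{a;i,j}^{(r)},[E_{a;h,k}^{(s)},E_{b;f,g}^{(l)}]\big]+\big[E_{a;i,j}^{(s)},[E_{a;h,k}^{(r)},E_{b;f,g}^{(l)}]\big]=0\quad(a\ne b),\text{ and the same with } F \text{ for } E,\\ &\big[[E_{m-1;i,j}^{(r)},E_{m;h,k}^{(1)}],[E_{m;h_0,k_0}^{(1)},E_{m+1;f,g}^{(s)}]\big]=0\quad(m>1,\ n>1),\text{ and the same with } F \text{ for } E. \end{align*} Put $E_{a,a+1;i,j}^{(r)}=E_{a;i,j}^{(r)}$, $F_{a+1,a;i,j}^{(r)}=F_{a;i,j}^{(r)}$ and, for $b>a+1$ and $r\ge 1$, define recursively in $\widehat Y_\mu$ $$E_{a,b;i,j}^{(r)}=(-1)^{\overline{b-1}}[E_{a,b-1;i,k}^{(r)},E_{b-1;k,j}^{(1)}],\qquad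 F_{b,a;i,j}^{(r)}=(-1)^{\overline{b-1}}[F_{b-1;i,k}^{(1)},F_{b-1,a;k,j}^{(r)}].$$ These elements do not depend on the choice of $1\le k\le\mu_{b-1}$ (at each step), and have parity $\bar a+\bar b$. (1) For every total order on the (labels of the) elements $D_{a;i,j}^{(r)}$ ($1\le a\le m+n$), $E_{a,b;i,j}^{(r)}$, $F_{b,a;i,j}^{(r)}$ ($1\le a<b\le m+n$), $r\ge1$, the monomials in these elements taken in this order, and containing no second or higher power of an odd element, span $\widehat Y_\mu$ as a vector space. (2) Let $\widehat Y^+_\mu$ be the subalgebra generated by all $E_{a,b;i,j}^{(r)}$. The loop filtration of $\widehat Y_\mu$ (resp. $\widehat Y^+_\mu$) has as its $k$-th term the span of all monomials of total degree $\le k$ in the elements $D_{a;i,j}^{(r)}$, $E_{a,b;i,j}^{(r)}$, $F_{b,a;i,j}^{(r)}$ (resp. in the elements $E_{a,b;i,j}^{(r)}$), $r\ge 1$, where each of these elements has degree $r-1$. Let $\bar E_{a,b;i,j}^{(r)}$ be the image of $E_{a,b;i,j}^{(r)}$ in the degree $r-1$ component of the associated graded algebra. Then in $gr^L\widehat Y^+_\mu$,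 and also in $gr^L\widehat Y_\mu$, for all admissible $a<b$, $c<d$, $i,j,h,k$ and $r,s\ge 1$, $$[\bar E_{a,b;i,j}^{(r)},\bar E_{c,d;h,k}^{(s)}]=(-1)^{\bar b}\delta_{b,c}\delta_{h,j}\bar E_{a,d;i,k}^{(r+s-1)}-(-1)^{\bar a\bar b+\bar a\bar c+\bar b\bar c}\delta_{a,d}\delta_{i,k}\bar E_{c,b;h,j}^{(r+s-1)}.$$ -/

import Mathlib

noncomputable section

namespace SuperYangian

/-- The parity of the block position `a`. Block positions are numbered `0, 1, …, m + n - 1`;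
the first `m` of them are even (parity `0`), the others are odd (parity `1`). -/
def par (m a : ℕ) : ℕ := if a < m then 0 else 1

/-- The supercommutator `x y - (-1)^(p q) y x` of homogeneous elements `x` of parity `p` and `y`
of parity `q` (parities are natural numbers, read modulo `2`). -/
def sbr {A : Type*} [Ring A] (p q : ℕ) (x y : A) : A := x * y - (-1) ^ (p * q) * (y * x)

/-! ### The abstract algebra

The composition is `μ : Fin (m + n) → ℕ+`: its first `m` values are the parts of a composition of
`M`, its last `n` values are the parts of a composition of `N`. -/

/-- The generators. `D a i j r` and `Dinv a i j r` stand for the elements with upper index `r ≥ 0`.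
`E a b _ i j r` and `F a b _ i j r`, where `b` is the block position next to `a`, stand for the
elements `E_{a;i,j}^{(r+1)}` and `F_{a;i,j}^{(r+1)}`, so that their upper indices are `≥ 1`. -/
inductive Gen {m n : ℕ} (μ : Fin (m + n) → ℕ+) : Type
  | D (a : Fin (m + n)) (i j : Fin (μ a)) (r : ℕ) : Gen μ
  | Dinv (a : Fin (m + n)) (i j : Fin (μ a)) (r : ℕ) : Gen μ
  | E (a b : Fin (m + n)) (hab : a.val + 1 = b.val) (i : Fin (μ a)) (j : Fin (μ b)) (r : ℕ) : Gen μ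
  | F (a b : Fin (m + n)) (hab : a.val + 1 = b.val) (i : Fin (μ b)) (j : Fin (μ a)) (r : ℕ) : Gen μ

variable {m n : ℕ} {μ : Fin (m + n) → ℕ+}

/-- `D_{a;i,j}^{(r)}`, `r ≥ 0`, in the free algebra. -/
def fD (a : Fin (m + n)) (i j : Fin (μ a)) (r : ℕ) : FreeAlgebra ℂ (Gen μ) :=
  FreeAlgebra.ι ℂ (Gen.D a i j r)

/-- The entries `D'_{a;i,j}^{(r)}`, `r ≥ 0`, of the inverse matrix, in the free algebra. -/
def fDinv (a : Fin (m + n)) (i j : Fin (μ a)) (r : ℕ) : FreeAlgebra ℂ (Gen μ) :=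
  FreeAlgebra.ι ℂ (Gen.Dinv a i j r)

/-- `E_{a;i,j}^{(r)}` in the free algebra, for the neighbouring blocks `a` and `b = a + 1`. The
upper index is `r ≥ 1`; for `r = 0` we put `0`. -/
def fE (a b : Fin (m + n)) (hab : a.val + 1 = b.val) (i : Fin (μ a)) (j : Fin (μ b)) :
    ℕ → FreeAlgebra ℂ (Gen μ)
  | 0 => 0
  | r + 1 => FreeAlgebra.ι ℂ (Gen.E a b hab i j r)

/-- `F_{a;i,j}^{(r)}` in the free algebra, for the neighbouring blocks `a` and `b = a + 1`. The
upper index is `r ≥ 1`; for `r = 0` we put `0`. -/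
def fF (a b : Fin (m + n)) (hab : a.val + 1 = b.val) (i : Fin (μ b)) (j : Fin (μ a)) :
    ℕ → FreeAlgebra ℂ (Gen μ)
  | 0 => 0
  | r + 1 => FreeAlgebra.ι ℂ (Gen.F a b hab i j r)

variable (μ) in
/-- The defining relations. The `D`'s are even; `E_a` and `F_a`, with `b = a + 1`, have the parity
`par m a + par m b`, which is odd exactly if `a` is the last even block. The two cases (`a` is, or
is not, the last even block) of several relations are written with one sign in `par m a` or
`par m b`: these two parities agree unless `a` is the last even block, where they are `0` and
`1`. -/
inductive Rel : FreeAlgebra ℂ (Gen μ) → FreeAlgebra ℂ (Gen μ) → Prop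
  | D_zero (a : Fin (m + n)) (i j : Fin (μ a)) :
      Rel (fD a i j 0) (if i = j then 1 else 0)
  | D_Dinv (a : Fin (m + n)) (i j : Fin (μ a)) (r : ℕ) :
      Rel (∑ t ∈ Finset.range (r + 1), ∑ p : Fin (μ a), fD a i p t * fDinv a p j (r - t))
        (if r = 0 ∧ i = j then 1 else 0)
  | D_D (a : Fin (m + n)) (i j h k : Fin (μ a)) (r s : ℕ) :
      Rel (sbr 0 0 (fD a i j r) (fD a h k s))
        ((-1) ^ par m a * ∑ t ∈ Finset.range (min r s),
          (fD a h j t * fD a i k (r + s - 1 - t) - fD a h j (r + s - 1 - t) * fD a i k t))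
  | D_D_ne (a b : Fin (m + n)) (hne : a ≠ b) (i j : Fin (μ a)) (h k : Fin (μ b)) (r s : ℕ) :
      Rel (sbr 0 0 (fD a i j r) (fD b h k s)) 0
  | D_E_left (a b : Fin (m + n)) (hab : a.val + 1 = b.val)
      (i j h : Fin (μ a)) (k : Fin (μ b)) (r s : ℕ) (hs : 1 ≤ s) :
      Rel (sbr 0 (par m a + par m b) (fD a i j r) (fE a b hab h k s))
        ((-1) ^ par m a * (if h = j then
          ∑ t ∈ Finset.range r, ∑ p : Fin (μ a), fD a i p t * fE a b hab p k (r + s - 1 - t)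
          else 0))
  | D_E_right (a b : Fin (m + n)) (hab : a.val + 1 = b.val)
      (i j : Fin (μ b)) (h : Fin (μ a)) (k : Fin (μ b)) (r s : ℕ) (hs : 1 ≤ s) :
      Rel (sbr 0 (par m a + par m b) (fD b i j r) (fE a b hab h k s))
        (-((-1) ^ par m b *
          ∑ t ∈ Finset.range r, fD b i k t * fE a b hab h j (r + s - 1 - t)))
  | D_E_ne (c a b : Fin (m + n)) (hab : a.val + 1 = b.val) (hca : c ≠ a) (hcb : c ≠ b)
      (i j : Fin (μ c)) (h : Fin (μ a)) (k : Fin (μ b)) (r s : ℕ) (hs : 1 ≤ s) :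
      Rel (sbr 0 (par m a + par m b) (fD c i j r) (fE a b hab h k s)) 0
  | D_F_left (a b : Fin (m + n)) (hab : a.val + 1 = b.val)
      (i j : Fin (μ a)) (h : Fin (μ b)) (k : Fin (μ a)) (r s : ℕ) (hs : 1 ≤ s) :
      Rel (sbr 0 (par m a + par m b) (fD a i j r) (fF a b hab h k s))
        (-((-1) ^ par m a * (if k = i then
          ∑ t ∈ Finset.range r, ∑ p : Fin (μ a), fF a b hab h p (r + s - 1 - t) * fD a p j t
          else 0)))
  | D_F_right (a b : Fin (m + n)) (hab : a.val + 1 = b.val)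
      (i j h : Fin (μ b)) (k : Fin (μ a)) (r s : ℕ) (hs : 1 ≤ s) :
      Rel (sbr 0 (par m a + par m b) (fD b i j r) (fF a b hab h k s))
        ((-1) ^ par m b *
          ∑ t ∈ Finset.range r, fF a b hab i k (r + s - 1 - t) * fD b h j t)
  | D_F_ne (c a b : Fin (m + n)) (hab : a.val + 1 = b.val) (hca : c ≠ a) (hcb : c ≠ b)
      (i j : Fin (μ c)) (h : Fin (μ b)) (k : Fin (μ a)) (r s : ℕ) (hs : 1 ≤ s) :
      Rel (sbr 0 (par m a + par m b) (fD c i j r) (fF a b hab h k s)) 0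
  | E_E (a b : Fin (m + n)) (hab : a.val + 1 = b.val)
      (i : Fin (μ a)) (j : Fin (μ b)) (h : Fin (μ a)) (k : Fin (μ b))
      (r s : ℕ) (hr : 1 ≤ r) (hs : 1 ≤ s) :
      Rel (sbr (par m a + par m b) (par m a + par m b) (fE a b hab i j r) (fE a b hab h k s))
        ((-1) ^ par m b *
          (∑ t ∈ Finset.Ico 1 s, fE a b hab i k t * fE a b hab h j (r + s - 1 - t)
            - ∑ t ∈ Finset.Ico 1 r, fE a b hab i k t * fE a b hab h j (r + s - 1 - t)))
  | F_F (a b : Fin (m + n)) (hab : a.val + 1 = b.val)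
      (i : Fin (μ b)) (j : Fin (μ a)) (h : Fin (μ b)) (k : Fin (μ a))
      (r s : ℕ) (hr : 1 ≤ r) (hs : 1 ≤ s) :
      Rel (sbr (par m a + par m b) (par m a + par m b) (fF a b hab i j r) (fF a b hab h k s))
        ((-1) ^ par m a *
          (∑ t ∈ Finset.Ico 1 r, fF a b hab i k (r + s - 1 - t) * fF a b hab h j t
            - ∑ t ∈ Finset.Ico 1 s, fF a b hab i k (r + s - 1 - t) * fF a b hab h j t))
  | E_F (a b : Fin (m + n)) (hab : a.val + 1 = b.val)
      (i : Fin (μ a)) (j h : Fin (μ b)) (k : Fin (μ a))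
      (r s : ℕ) (hr : 1 ≤ r) (hs : 1 ≤ s) :
      Rel (sbr (par m a + par m b) (par m a + par m b) (fE a b hab i j r) (fF a b hab h k s))
        (-((-1) ^ par m b *
          ∑ t ∈ Finset.range (r + s), fD b h j (r + s - 1 - t) * fDinv a i k t))
  | E_F_ne (a b c d : Fin (m + n)) (hab : a.val + 1 = b.val) (hcd : c.val + 1 = d.val)
      (hne : a ≠ c) (i : Fin (μ a)) (j : Fin (μ b)) (h : Fin (μ d)) (k : Fin (μ c))
      (r s : ℕ) (hr : 1 ≤ r) (hs : 1 ≤ s) :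
      Rel (sbr (par m a + par m b) (par m c + par m d) (fE a b hab i j r) (fF c d hcd h k s)) 0
  | E_E_next (a b c : Fin (m + n)) (hab : a.val + 1 = b.val) (hbc : b.val + 1 = c.val)
      (i : Fin (μ a)) (j h : Fin (μ b)) (k : Fin (μ c)) (r s : ℕ) (hr : 1 ≤ r) (hs : 1 ≤ s) :
      Rel (sbr (par m a + par m b) (par m b + par m c) (fE a b hab i j (r + 1)) (fE b c hbc h k s)
          - sbr (par m a + par m b) (par m b + par m c) (fE a b hab i j r) (fE b c hbc h k (s + 1)))
        ((-1) ^ par m b * (if h = j then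
          ∑ q : Fin (μ b), fE a b hab i q r * fE b c hbc q k s else 0))
  | F_F_next (a b c : Fin (m + n)) (hab : a.val + 1 = b.val) (hbc : b.val + 1 = c.val)
      (i : Fin (μ b)) (j : Fin (μ a)) (h : Fin (μ c)) (k : Fin (μ b))
      (r s : ℕ) (hr : 1 ≤ r) (hs : 1 ≤ s) :
      Rel (sbr (par m a + par m b) (par m b + par m c) (fF a b hab i j (r + 1)) (fF b c hbc h k s)
          - sbr (par m a + par m b) (par m b + par m c) (fF a b hab i j r) (fF b c hbc h k (s + 1)))
        (-((-1) ^ par m b * (if i = k then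
          ∑ q : Fin (μ b), fF b c hbc h q s * fF a b hab q j r else 0)))
  | E_E_far (a b c d : Fin (m + n)) (hab : a.val + 1 = b.val) (hcd : c.val + 1 = d.val)
      (hfar : a.val + 1 < c.val) (i : Fin (μ a)) (j : Fin (μ b)) (h : Fin (μ c)) (k : Fin (μ d))
      (r s : ℕ) (hr : 1 ≤ r) (hs : 1 ≤ s) :
      Rel (sbr (par m a + par m b) (par m c + par m d) (fE a b hab i j r) (fE c d hcd h k s)) 0
  | E_E_ne (a b c : Fin (m + n)) (hab : a.val + 1 = b.val) (hbc : b.val + 1 = c.val)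
      (i : Fin (μ a)) (j h : Fin (μ b)) (k : Fin (μ c)) (hne : h ≠ j)
      (r s : ℕ) (hr : 1 ≤ r) (hs : 1 ≤ s) :
      Rel (sbr (par m a + par m b) (par m b + par m c) (fE a b hab i j r) (fE b c hbc h k s)) 0
  | F_F_far (a b c d : Fin (m + n)) (hab : a.val + 1 = b.val) (hcd : c.val + 1 = d.val)
      (hfar : a.val + 1 < c.val) (i : Fin (μ b)) (j : Fin (μ a)) (h : Fin (μ d)) (k : Fin (μ c))
      (r s : ℕ) (hr : 1 ≤ r) (hs : 1 ≤ s) :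
      Rel (sbr (par m a + par m b) (par m c + par m d) (fF a b hab i j r) (fF c d hcd h k s)) 0
  | F_F_ne (a b c : Fin (m + n)) (hab : a.val + 1 = b.val) (hbc : b.val + 1 = c.val)
      (i : Fin (μ b)) (j : Fin (μ a)) (h : Fin (μ c)) (k : Fin (μ b)) (hne : i ≠ k)
      (r s : ℕ) (hr : 1 ≤ r) (hs : 1 ≤ s) :
      Rel (sbr (par m a + par m b) (par m b + par m c) (fF a b hab i j r) (fF b c hbc h k s)) 0
  | E_serre (a b c d : Fin (m + n)) (hab : a.val + 1 = b.val) (hcd : c.val + 1 = d.val)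
      (hne : a ≠ c) (i : Fin (μ a)) (j : Fin (μ b)) (h : Fin (μ a)) (k : Fin (μ b))
      (f : Fin (μ c)) (g : Fin (μ d)) (r s l : ℕ) (hr : 1 ≤ r) (hs : 1 ≤ s) (hl : 1 ≤ l) :
      Rel (sbr (par m a + par m b) (par m a + par m b + (par m c + par m d)) (fE a b hab i j r)
            (sbr (par m a + par m b) (par m c + par m d) (fE a b hab h k s) (fE c d hcd f g l))
          + sbr (par m a + par m b) (par m a + par m b + (par m c + par m d)) (fE a b hab i j s)
            (sbr (par m a + par m b) (par m c + par m d) (fE a b hab h k r) (fE c d hcd f g l)))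
        0
  | F_serre (a b c d : Fin (m + n)) (hab : a.val + 1 = b.val) (hcd : c.val + 1 = d.val)
      (hne : a ≠ c) (i : Fin (μ b)) (j : Fin (μ a)) (h : Fin (μ b)) (k : Fin (μ a))
      (f : Fin (μ d)) (g : Fin (μ c)) (r s l : ℕ) (hr : 1 ≤ r) (hs : 1 ≤ s) (hl : 1 ≤ l) :
      Rel (sbr (par m a + par m b) (par m a + par m b + (par m c + par m d)) (fF a b hab i j r)
            (sbr (par m a + par m b) (par m c + par m d) (fF a b hab h k s) (fF c d hcd f g l))
          + sbr (par m a + par m b) (par m a + par m b + (par m c + par m d)) (fF a b hab i j s)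
            (sbr (par m a + par m b) (par m c + par m d) (fF a b hab h k r) (fF c d hcd f g l)))
        0
  | E_quartic (a b c d : Fin (m + n)) (hab : a.val + 1 = b.val) (hbc : b.val + 1 = c.val)
      (hcd : c.val + 1 = d.val) (hm : b.val + 1 = m)
      (i : Fin (μ a)) (j h : Fin (μ b)) (k : Fin (μ c)) (h₀ : Fin (μ b)) (k₀ f : Fin (μ c))
      (g : Fin (μ d)) (r s : ℕ) (hr : 1 ≤ r) (hs : 1 ≤ s) :
      Rel (sbr (par m a + par m b + (par m b + par m c)) (par m b + par m c + (par m c + par m d))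
        (sbr (par m a + par m b) (par m b + par m c) (fE a b hab i j r) (fE b c hbc h k 1))
        (sbr (par m b + par m c) (par m c + par m d) (fE b c hbc h₀ k₀ 1) (fE c d hcd f g s))) 0
  | F_quartic (a b c d : Fin (m + n)) (hab : a.val + 1 = b.val) (hbc : b.val + 1 = c.val)
      (hcd : c.val + 1 = d.val) (hm : b.val + 1 = m)
      (i : Fin (μ b)) (j : Fin (μ a)) (h : Fin (μ c)) (k : Fin (μ b)) (h₀ : Fin (μ c))
      (k₀ : Fin (μ b)) (f : Fin (μ d)) (g : Fin (μ c)) (r s : ℕ) (hr : 1 ≤ r) (hs : 1 ≤ s) :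
      Rel (sbr (par m a + par m b + (par m b + par m c)) (par m b + par m c + (par m c + par m d))
        (sbr (par m a + par m b) (par m b + par m c) (fF a b hab i j r) (fF b c hbc h k 1))
        (sbr (par m b + par m c) (par m c + par m d) (fF b c hbc h₀ k₀ 1) (fF c d hcd f g s))) 0

variable (μ) in
/-- The abstract algebra defined by the generators and relations above. -/
abbrev Yhat : Type := RingQuot (Rel μ)

variable (μ) in
/-- The quotient map from the free algebra. -/
def toYhat : FreeAlgebra ℂ (Gen μ) →ₐ[ℂ] Yhat μ := RingQuot.mkAlgHom ℂ (Rel μ)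

/-- `D_{a;i,j}^{(r)}` in the abstract algebra. -/
def yD (a : Fin (m + n)) (i j : Fin (μ a)) (r : ℕ) : Yhat μ := toYhat μ (fD a i j r)

/-- `E_{a;i,j}^{(r)} = E_{a,b;i,j}^{(r)}` in the abstract algebra, `b = a + 1`. -/
def yE (a b : Fin (m + n)) (hab : a.val + 1 = b.val) (i : Fin (μ a)) (j : Fin (μ b)) (r : ℕ) :
    Yhat μ := toYhat μ (fE a b hab i j r)

/-- `F_{a;i,j}^{(r)} = F_{b,a;i,j}^{(r)}` in the abstract algebra, `b = a + 1`. -/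
def yF (a b : Fin (m + n)) (hab : a.val + 1 = b.val) (i : Fin (μ b)) (j : Fin (μ a)) (r : ℕ) :
    Yhat μ := toYhat μ (fF a b hab i j r)

/-- Auxiliary recursion on the block position `b` for `E_{a,b;i,j}^{(r)}`, see `rootE`. -/
def rootEAux (a : Fin (m + n)) : (b : ℕ) → (hb : b < m + n) → a.val < b →
    Fin (μ a) → Fin (μ ⟨b, hb⟩) → ℕ → Yhat μ
  | 0, _, hab, _, _, _ => absurd hab (Nat.not_lt_zero _)
  | b + 1, hb, hab, i, j, r =>
    if h : a.val = b then yE a ⟨b + 1, hb⟩ (congrArg (· + 1) h) i j r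
    else (-1) ^ par m b *
      sbr (par m a + par m b) (par m b + par m (b + 1))
        (rootEAux a b (Nat.lt_of_succ_lt hb) (Nat.lt_of_le_of_ne (Nat.le_of_lt_succ hab) h)
          i ⟨0, (μ ⟨b, Nat.lt_of_succ_lt hb⟩).pos⟩ r)
        (yE ⟨b, Nat.lt_of_succ_lt hb⟩ ⟨b + 1, hb⟩ rfl
          ⟨0, (μ ⟨b, Nat.lt_of_succ_lt hb⟩).pos⟩ j 1)

/-- The elements `E_{a,b;i,j}^{(r)}`, `a < b`: for `b = a + 1` they are the generators, and for
`b > a + 1` they are `(-1)^{par (b-1)} [E_{a,b-1;i,k}^{(r)}, E_{b-1;k,j}^{(1)}]`. The definition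
takes for `k` the first index of the block `b - 1`. -/
def rootE (a b : Fin (m + n)) (hab : a < b) (i : Fin (μ a)) (j : Fin (μ b)) (r : ℕ) : Yhat μ :=
  rootEAux a b.val b.isLt hab i j r

/-- Auxiliary recursion on the block position `b` for `F_{b,a;i,j}^{(r)}`, see `rootF`. -/
def rootFAux (a : Fin (m + n)) : (b : ℕ) → (hb : b < m + n) → a.val < b →
    Fin (μ ⟨b, hb⟩) → Fin (μ a) → ℕ → Yhat μ
  | 0, _, hab, _, _, _ => absurd hab (Nat.not_lt_zero _)
  | b + 1, hb, hab, i, j, r =>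
    if h : a.val = b then yF a ⟨b + 1, hb⟩ (congrArg (· + 1) h) i j r
    else (-1) ^ par m b *
      sbr (par m b + par m (b + 1)) (par m a + par m b)
        (yF ⟨b, Nat.lt_of_succ_lt hb⟩ ⟨b + 1, hb⟩ rfl
          i ⟨0, (μ ⟨b, Nat.lt_of_succ_lt hb⟩).pos⟩ 1)
        (rootFAux a b (Nat.lt_of_succ_lt hb) (Nat.lt_of_le_of_ne (Nat.le_of_lt_succ hab) h)
          ⟨0, (μ ⟨b, Nat.lt_of_succ_lt hb⟩).pos⟩ j r)

/-- The elements `F_{b,a;i,j}^{(r)}`, `a < b`: for `b = a + 1` they are the generators, and for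
`b > a + 1` they are `(-1)^{par (b-1)} [F_{b-1;i,k}^{(1)}, F_{b-1,a;k,j}^{(r)}]`. The definition
takes for `k` the first index of the block `b - 1`. -/
def rootF (a b : Fin (m + n)) (hab : a < b) (i : Fin (μ b)) (j : Fin (μ a)) (r : ℕ) : Yhat μ :=
  rootFAux a b.val b.isLt hab i j r

/-! ### Monomials -/

variable (μ) in
/-- The labels of the elements `D_{a;i,j}^{(r+1)}`, `E_{a,b;i,j}^{(r+1)}`, `F_{b,a;i,j}^{(r+1)}`
with `a < b` and `r ≥ 0`. -/
inductive Root : Type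
  | D (a : Fin (m + n)) (i j : Fin (μ a)) (r : ℕ) : Root
  | E (a b : Fin (m + n)) (hab : a < b) (i : Fin (μ a)) (j : Fin (μ b)) (r : ℕ) : Root
  | F (a b : Fin (m + n)) (hab : a < b) (i : Fin (μ b)) (j : Fin (μ a)) (r : ℕ) : Root

/-- The element with a given label. -/
def Root.elt : Root μ → Yhat μ
  | .D a i j r => yD a i j (r + 1)
  | .E a b hab i j r => rootE a b hab i j (r + 1)
  | .F a b hab i j r => rootF a b hab i j (r + 1)

/-- The loop degree: elements with upper index `r + 1` have degree `r`. -/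
def Root.deg : Root μ → ℕ
  | .D _ _ _ r => r
  | .E _ _ _ _ _ r => r
  | .F _ _ _ _ _ r => r

/-- The element with this label is odd. -/
def Root.IsOdd : Root μ → Prop
  | .D _ _ _ _ => False
  | .E a b _ _ _ _ => Odd (par m a + par m b)
  | .F a b _ _ _ _ => Odd (par m a + par m b)

/-- The monomial with factors `l` is taken in the order `ord`, and contains no second or higher
power of an odd element. -/
def IsOrdered (ord : LinearOrder (Root μ)) (l : List (Root μ)) : Prop :=
  l.Pairwise fun x y => ord.lt x y ∨ (x = y ∧ ¬ x.IsOdd)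

/-! ### The filtration generated by a family of elements with degrees, and its graded algebra -/

section Graded

variable {A : Type*} [Ring A] [Algebra ℂ A] {I : Type*}

/-- `L_k`: the span of all monomials in the elements `x i` of total degree `≤ k`. -/
def fil (x : I → A) (deg : I → ℕ) (k : ℕ) : Submodule ℂ A :=
  Submodule.span ℂ {y | ∃ l : List I, (l.map deg).sum ≤ k ∧ y = (l.map x).prod}

/-- `L_{k-1}`, where `L_{-1} = 0`: the span of all monomials of total degree `< k`. -/
def filLT (x : I → A) (deg : I → ℕ) (k : ℕ) : Submodule ℂ A :=
  Submodule.span ℂ {y | ∃ l : List I, (l.map deg).sum < k ∧ y = (l.map x).prod}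

theorem fil_mul_fil {x : I → A} {deg : I → ℕ} {k l : ℕ} {y z : A}
    (hy : y ∈ fil x deg k) (hz : z ∈ fil x deg l) : y * z ∈ fil x deg (k + l) := by
  have h := Submodule.mul_mem_mul hy hz
  unfold fil at h
  rw [Submodule.span_mul_span] at h
  refine Submodule.span_mono ?_ h
  rintro _ ⟨_, ⟨u, hu, rfl⟩, _, ⟨v, hv, rfl⟩, rfl⟩
  exact ⟨u ++ v, by simpa using by omega, by simp⟩

theorem filLT_mul_fil {x : I → A} {deg : I → ℕ} {k l : ℕ} {y z : A}
    (hy : y ∈ filLT x deg k) (hz : z ∈ fil x deg l) : y * z ∈ filLT x deg (k + l) := by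
  have h := Submodule.mul_mem_mul hy hz
  unfold fil filLT at h
  rw [Submodule.span_mul_span] at h
  refine Submodule.span_mono ?_ h
  rintro _ ⟨_, ⟨u, hu, rfl⟩, _, ⟨v, hv, rfl⟩, rfl⟩
  exact ⟨u ++ v, by simpa using by omega, by simp⟩

theorem fil_mul_filLT {x : I → A} {deg : I → ℕ} {k l : ℕ} {y z : A}
    (hy : y ∈ fil x deg k) (hz : z ∈ filLT x deg l) : y * z ∈ filLT x deg (k + l) := by
  have h := Submodule.mul_mem_mul hy hz
  unfold fil filLT at h
  rw [Submodule.span_mul_span] at h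
  refine Submodule.span_mono ?_ h
  rintro _ ⟨_, ⟨u, hu, rfl⟩, _, ⟨v, hv, rfl⟩, rfl⟩
  exact ⟨u ++ v, by simpa using by omega, by simp⟩

theorem algebraMap_mem_fil (x : I → A) (deg : I → ℕ) (k : ℕ) (c : ℂ) :
    algebraMap ℂ A c ∈ fil x deg k := by
  rw [Algebra.algebraMap_eq_smul_one]
  exact Submodule.smul_mem _ _ (Submodule.subset_span ⟨[], by simp, by simp⟩)

theorem gen_mem_fil (x : I → A) (deg : I → ℕ) (i : I) : x i ∈ fil x deg (deg i) :=
  Submodule.subset_span ⟨[i], by simp, by simp⟩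

/-- The algebra `⨁ k, L_k t^k`, as a subalgebra of the polynomial ring `A[t]`. -/
def rees (x : I → A) (deg : I → ℕ) : Subalgebra ℂ (Polynomial A) where
  carrier := {p | ∀ k, p.coeff k ∈ fil x deg k}
  mul_mem' := by
    intro p q hp hq k
    rw [Polynomial.coeff_mul]
    refine Submodule.sum_mem _ fun c hc => ?_
    have hk : c.1 + c.2 = k := by simpa using hc
    rw [← hk]
    exact fil_mul_fil (hp _) (hq _)
  add_mem' := by
    intro p q hp hq k
    rw [Polynomial.coeff_add]
    exact Submodule.add_mem _ (hp k) (hq k)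
  algebraMap_mem' := by
    intro c k
    rw [Polynomial.algebraMap_apply, Polynomial.coeff_C]
    split_ifs
    · exact algebraMap_mem_fil _ _ _ _
    · exact Submodule.zero_mem _

/-- The two-sided ideal `⨁ k, L_{k-1} t^k` of the algebra `⨁ k, L_k t^k`. -/
def reesLT (x : I → A) (deg : I → ℕ) : Ideal (rees x deg) where
  carrier := {p | ∀ k, (p : Polynomial A).coeff k ∈ filLT x deg k}
  zero_mem' := by
    intro k
    simp
  add_mem' := by
    intro p q hp hq k
    rw [Subalgebra.coe_add, Polynomial.coeff_add]
    exact Submodule.add_mem _ (hp k) (hq k)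
  smul_mem' := by
    intro p q hq k
    rw [smul_eq_mul, Subalgebra.coe_mul, Polynomial.coeff_mul]
    refine Submodule.sum_mem _ fun c hc => ?_
    have hk : c.1 + c.2 = k := by simpa using hc
    rw [← hk]
    exact fil_mul_filLT (p.2 _) (hq _)

instance reesLT_isTwoSided (x : I → A) (deg : I → ℕ) : (reesLT x deg).IsTwoSided where
  mul_mem_of_left := by
    intro p q hp k
    rw [Subalgebra.coe_mul, Polynomial.coeff_mul]
    refine Submodule.sum_mem _ fun c hc => ?_
    have hk : c.1 + c.2 = k := by simpa using hc
    rw [← hk]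
    exact filLT_mul_fil (hp _) (q.2 _)

/-- The associated graded algebra `⨁ k, L_k / L_{k-1}`, as the quotient of `⨁ k, L_k t^k` by its
ideal `⨁ k, L_{k-1} t^k`. -/
abbrev Gr (x : I → A) (deg : I → ℕ) : Type _ := rees x deg ⧸ reesLT x deg

/-- The image of `y ∈ L_k` in the component `L_k / L_{k-1}` of the associated graded algebra. -/
def Gr.cls (x : I → A) (deg : I → ℕ) (k : ℕ) (y : A) (hy : y ∈ fil x deg k) : Gr x deg :=
  Ideal.Quotient.mk (reesLT x deg) ⟨Polynomial.monomial k y, by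
    intro l
    rw [Polynomial.coeff_monomial]
    split_ifs with h
    · exact h ▸ hy
    · exact Submodule.zero_mem _⟩

end Graded

variable (μ) in
/-- The subalgebra generated by the elements `E_{a,b;i,j}^{(r)}`. -/
def Yplus : Subalgebra ℂ (Yhat μ) :=
  Algebra.adjoin ℂ {y | ∃ (a b : Fin (m + n)) (hab : a < b) (i : Fin (μ a)) (j : Fin (μ b)) (r : ℕ),
    y = rootE a b hab i j (r + 1)}

variable (μ) in
/-- The labels of the elements `E_{a,b;i,j}^{(r+1)}`, `a < b`, `r ≥ 0`. -/
structure EIdx where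
  a : Fin (m + n)
  b : Fin (m + n)
  hab : a < b
  i : Fin (μ a)
  j : Fin (μ b)
  r : ℕ

/-- The element `E_{a,b;i,j}^{(r+1)}` of `Yplus`. -/
def EIdx.elt (e : EIdx μ) : Yplus μ :=
  ⟨rootE e.a e.b e.hab e.i e.j (e.r + 1),
    Algebra.subset_adjoin ⟨e.a, e.b, e.hab, e.i, e.j, e.r, rfl⟩⟩

variable (μ) in
/-- The associated graded algebra of `Yhat` for the loop filtration. -/
abbrev GrYhat : Type := Gr (Root.elt (μ := μ)) Root.deg

variable (μ) in
/-- The associated graded algebra of `Yplus` for the loop filtration. -/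
abbrev GrYplus : Type := Gr (EIdx.elt (μ := μ)) EIdx.r

/-- The image of `E_{a,b;i,j}^{(r+1)}` in the degree `r` component of the graded algebra of
`Yhat`. -/
def ebar (a b : Fin (m + n)) (hab : a < b) (i : Fin (μ a)) (j : Fin (μ b)) (r : ℕ) : GrYhat μ :=
  Gr.cls Root.elt Root.deg r (rootE a b hab i j (r + 1))
    (gen_mem_fil Root.elt Root.deg (Root.E a b hab i j r))

/-- The image of `E_{a,b;i,j}^{(r+1)}` in the degree `r` component of the graded algebra of
`Yplus`. -/
def ebarPlus (a b : Fin (m + n)) (hab : a < b) (i : Fin (μ a)) (j : Fin (μ b)) (r : ℕ) :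
    GrYplus μ :=
  Gr.cls EIdx.elt EIdx.r r (EIdx.elt ⟨a, b, hab, i, j, r⟩)
    (gen_mem_fil EIdx.elt EIdx.r ⟨a, b, hab, i, j, r⟩)

end SuperYangian

end

/-! In top degree the classes of the elements `D`, `E`, `F` satisfy the relations of the loop
superalgebra gl_{M|N}[t]: up to signs, the element with row x, column y and upper index r + 1
behaves like the matrix unit e_{xy} times t^r. The predicate `Comm` expresses this, and both the
bracket formula and the spanning statement follow from it.

Between generators it is a degree count: a quadratic term of a defining relation lies one degree
below the top unless it contains D^{(0)} = δ or D'^{(0)} = δ. For general root elements one writes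
t_{xw} as a bracket of t_{xy} and t_{yw} and uses the super Jacobi identity; `Comm.step` is this
reduction. In the upper triangular part (`UpperRel.comm`) the cases that need more than this are
t_{xy} against a longer t_{zw} sharing its first or last block, where the Serre relations apply, and
t_{xy} strictly inside t_{zw} (`UpperRel.comm_inner_three`), where two expansions of one bracket are
compared and the quartic relation is needed exactly where the parity changes. Transposition into the
opposite ring gives the lower triangular part, and the same induction gives the mixed brackets
(`FullRel.comm`).

That root elements do not depend on the intermediate index holds already before grading
(`RootRel.split`): for y ≠ z in one block [E_{xy}, E_{zw}] = 0, and bracketing this with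
D_{yz}^{(1)} identifies the expressions with intermediate index y and z.

The relation `Symbol` abstracts "a has class g in degree k", so that one argument serves the graded
algebras of both `Yhat` and `Yplus`.

For spanning, exchanging two neighbouring factors of a monomial costs only monomials of smaller
degree, or of the same degree with fewer factors, and the square of an odd element is half a
bracket. Induction on degree and then on length finishes the proof (`monom_mem_span_ordered`). -/

noncomputable section

namespace SuperYangian

open MulOpposite

/-! ### The supercommutator -/

section Sbr

variable {A : Type*} [Ring A]

theorem sign_cases (k : ℕ) : (-1 : A) ^ k = 1 ∨ (-1 : A) ^ k = -1 := neg_one_pow_eq_or A k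

theorem sign_congr {k l : ℕ} (h : k % 2 = l % 2) : (-1 : A) ^ k = (-1) ^ l := by
  rw [neg_one_pow_eq_pow_mod_two, h, ← neg_one_pow_eq_pow_mod_two]

theorem sign_mul_sign_mul (k : ℕ) (x : A) : (-1) ^ k * ((-1) ^ k * x) = x := by
  rcases sign_cases (A := A) k with h | h <;> simp [h]

theorem sign_mul_eq_zero {k : ℕ} {x : A} : (-1) ^ k * x = 0 ↔ x = 0 := by
  rcases sign_cases (A := A) k with h | h <;> simp [h]

theorem sbr_congr {p p' q q' : ℕ} (hp : p % 2 = p' % 2) (hq : q % 2 = q' % 2) (x y : A) :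
    sbr p q x y = sbr p' q' x y := by
  have : (p * q) % 2 = (p' * q') % 2 := by rw [Nat.mul_mod, hp, hq, ← Nat.mul_mod]
  rw [sbr, sbr, sign_congr this]

@[simp] theorem sbr_zero_left (p q : ℕ) (y : A) : sbr p q 0 y = 0 := by simp [sbr]

@[simp] theorem sbr_zero_right (p q : ℕ) (x : A) : sbr p q x 0 = 0 := by simp [sbr]

theorem sbr_sub_right (p q : ℕ) (x y z : A) : sbr p q x (y - z) = sbr p q x y - sbr p q x z := by
  simp only [sbr]; noncomm_ring

theorem sbr_neg_right (p q : ℕ) (x y : A) : sbr p q x (-y) = -sbr p q x y := by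
  simp only [sbr]; noncomm_ring

theorem sbr_neg_left (p q : ℕ) (x y : A) : sbr p q (-x) y = -sbr p q x y := by
  simp only [sbr]; noncomm_ring

theorem sbr_sign_left (p q k : ℕ) (x y : A) :
    sbr p q ((-1) ^ k * x) y = (-1) ^ k * sbr p q x y := by
  rcases sign_cases (A := A) k with h | h <;> simp [h, sbr_neg_left]

theorem sbr_sign_right (p q k : ℕ) (x y : A) :
    sbr p q x ((-1) ^ k * y) = (-1) ^ k * sbr p q x y := by
  rcases sign_cases (A := A) k with h | h <;> simp [h, sbr_neg_right]

theorem sbr_swap (p q : ℕ) (x y : A) : sbr p q x y = -((-1) ^ (p * q) * sbr q p y x) := by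
  rw [sbr, sbr, mul_comm q p]
  rcases sign_cases (A := A) (p * q) with h | h <;> simp [h, add_comm]

theorem sbr_eq_zero_comm {p q : ℕ} {x y : A} (h : sbr p q x y = 0) : sbr q p y x = 0 := by
  rw [sbr_swap, h]; simp

theorem sbr_self {p : ℕ} (h : Odd p) (x : A) : sbr p p x x = x * x + x * x := by
  rw [sbr, (h.mul h).neg_one_pow, neg_one_mul, sub_neg_eq_add]

theorem mul_sub_sign (k : ℕ) (x y z : A) :
    x * (y - (-1) ^ k * z) = x * y - (-1) ^ k * (x * z) := by
  rcases sign_cases (A := A) k with h | h <;> simp [h, mul_add, mul_sub]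

/-- The super Jacobi identity. -/
theorem sbr_jacobi (p q s : ℕ) (x y z : A) :
    sbr (p + q) s (sbr p q x y) z =
      sbr p (q + s) x (sbr q s y z) - (-1) ^ (p * q) * sbr q (p + s) y (sbr p s x z) := by
  have h1 : (-1 : A) ^ ((p + q) * s) = (-1) ^ (p * s) * (-1) ^ (q * s) := by
    rw [add_mul, pow_add]
  have h2 : (-1 : A) ^ (p * (q + s)) = (-1) ^ (p * q) * (-1) ^ (p * s) := by
    rw [mul_add, pow_add]
  have h3 : (-1 : A) ^ (q * (p + s)) = (-1) ^ (p * q) * (-1) ^ (q * s) := by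
    rw [mul_add, pow_add, mul_comm q p]
  simp only [sbr, h1, h2, h3]
  -- Once the exponents are split, only three independent signs remain; in each of the eight cases
  -- the claim is an identity in a free ring.
  rcases sign_cases (A := A) (p * q) with h | h <;>
  rcases sign_cases (A := A) (p * s) with h' | h' <;>
  rcases sign_cases (A := A) (q * s) with h'' | h'' <;>
  simp only [h, h', h''] <;> noncomm_ring

theorem sbr_jacobi' (p q s : ℕ) (x y z : A) :
    sbr p (q + s) x (sbr q s y z) =
      sbr (p + q) s (sbr p q x y) z + (-1) ^ (p * q) * sbr q (p + s) y (sbr p s x z) := by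
  rw [sbr_jacobi]; abel

/-- The opposite ring is taken without super signs, so the bracket merely reverses its arguments.
This is what allows statements about `E` to be transposed to `F`. -/
theorem op_sbr (p q : ℕ) (x y : A) : op (sbr p q x y) = sbr q p (op y) (op x) := by
  rw [sbr, sbr, mul_comm q p]
  rcases sign_cases (A := A) (p * q) with h | h
  · have h' : (-1 : Aᵐᵒᵖ) ^ (p * q) = 1 := by
      have := congrArg op h; simpa using this
    simp [h, h']
  · have h' : (-1 : Aᵐᵒᵖ) ^ (p * q) = -1 := by
      have := congrArg op h; simpa using this
    simp [h, h']

theorem op_sign_mul (k : ℕ) (x : A) : op ((-1) ^ k * x) = (-1) ^ k * op x := by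
  rcases Nat.even_or_odd k with h | h <;> simp [h.neg_one_pow]

theorem map_sbr {B : Type*} [Ring B] (f : A →+* B) (p q : ℕ) (x y : A) :
    f (sbr p q x y) = sbr p q (f x) (f y) := by
  simp [sbr]

end Sbr

/-! ### Matrix positions and the commutation relations of matrix units -/

variable {m n : ℕ} {μ : Fin (m + n) → ℕ+}

variable (μ) in
/-- A row or column of a block matrix: a block together with a position in it. -/
abbrev Pos : Type := Σ a : Fin (m + n), Fin (μ a)

/-- The block of a position. -/
def blk (x : Pos μ) : ℕ := x.1.val

/-- The parity of a position. -/
def pp (x : Pos μ) : ℕ := par m (blk x)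

theorem par_cases (m a : ℕ) : par m a = 0 ∨ par m a = 1 := by
  unfold par; split_ifs <;> simp

theorem pp_cases (x : Pos μ) : pp x = 0 ∨ pp x = 1 := par_cases _ _

theorem pp_congr {x y : Pos μ} (h : blk x = blk y) : pp x = pp y := by rw [pp, pp, h]

theorem ne_of_blk {x y : Pos μ} (h : blk x ≠ blk y) : x ≠ y := fun e => h (e ▸ rfl)

/-- The first position of the block of number `b`. -/
theorem exists_blk {w : Pos μ} {b : ℕ} (h : b ≤ blk w) : ∃ y : Pos μ, blk y = b :=
  ⟨⟨⟨b, h.trans_lt w.1.isLt⟩, ⟨0, (μ _).pos⟩⟩, rfl⟩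

section Comm

variable {G : Type*} [Ring G]

/-- The elements `t x y r`, `t z w s` commute like (signed) elementary matrices times powers of a
variable. -/
def Comm (t : Pos μ → Pos μ → ℕ → G) (x y z w : Pos μ) : Prop :=
  ∀ r s, sbr (pp x + pp y) (pp z + pp w) (t x y r) (t z w s) =
    (if y = z then (-1) ^ pp y * t x w (r + s) else 0) -
    (if x = w then (-1) ^ (pp x * pp y + pp x * pp z + pp y * pp z) * t z y (r + s) else 0)

/-- The transposed family in the opposite ring. -/
def transp (t : Pos μ → Pos μ → ℕ → G) (x y : Pos μ) (r : ℕ) : Gᵐᵒᵖ := op (t y x r)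

variable {t : Pos μ → Pos μ → ℕ → G}

theorem Comm.symm {x y z w : Pos μ} (h : Comm t x y z w) : Comm t z w x y := by
  intro r s
  rw [sbr_swap, h s r, add_comm s r]
  by_cases h1 : y = z
  · subst h1
    by_cases h2 : x = w
    · subst h2
      rcases pp_cases x with hx | hx <;> rcases pp_cases y with hy | hy <;> simp [hx, hy, pow_succ] <;> abel
    · simp only [h2, Ne.symm h2, if_true, if_false]
      rcases pp_cases x with hx | hx <;> rcases pp_cases y with hy | hy <;>
        rcases pp_cases w with hw | hw <;> simp [hx, hy, hw, pow_succ]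
  · by_cases h2 : x = w
    · subst h2
      simp only [h1, Ne.symm h1, if_true, if_false]
      rcases pp_cases x with hx | hx <;> rcases pp_cases y with hy | hy <;>
        rcases pp_cases z with hw | hw <;> simp [hx, hy, hw, pow_succ]
    · simp [h1, h2, Ne.symm h1, Ne.symm h2]

/-- Transposing matrix units reverses products, so the matrix unit relations reappear unchanged in
the opposite ring. The degrees r and s trade places with the two factors. -/
theorem comm_transp {x y z w : Pos μ} : Comm (transp t) x y z w ↔ Comm t w z y x := by
  refine forall_comm.trans (forall₂_congr fun r s => ?_)
  simp only [transp]
  rw [← op_sbr, ← op_injective.eq_iff (a := sbr _ _ _ _), add_comm (pp x), add_comm (pp z),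
    add_comm s r, op_sub, apply_ite op, apply_ite op, op_sign_mul, op_sign_mul]
  simp only [op_zero, eq_comm (a := z), eq_comm (a := w)]
  refine Eq.congr_right ?_
  congr 1
  · by_cases h : y = z
    · subst h; rfl
    · simp [h]
  · by_cases h : x = w
    · subst h
      simp only [if_true]
      congr 2
      ring
    · simp [h]

/-- Jacobi expands [[t_xy, t_yw], t_zv] into double brackets whose inner parts are given by `h1` and
`h2`. An inner bracket is nonzero only if two indices coincide, so the outer brackets are assumed,
in `h3` to `h6`, only under these coincidences. -/
theorem Comm.step {x y w z v : Pos μ} (hxy : x ≠ y) (hyw : y ≠ w) (hxw : x ≠ w)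
    (hrec : ∀ r, t x w r = (-1) ^ pp y * sbr (pp x + pp y) (pp y + pp w) (t x y r) (t y w 0))
    (h1 : Comm t x y z v) (h2 : Comm t y w z v)
    (h3 : w = z → Comm t x y y v) (h4 : y = v → Comm t x y z w)
    (h5 : y = z → Comm t y w x v) (h6 : x = v → Comm t y w z y) : Comm t x w z v := by
  intro r s
  rw [hrec, sbr_sign_left, sbr_congr (p := pp x + pp w) (p' := pp x + pp y + (pp y + pp w))
    (q := pp z + pp v) (by omega) rfl, sbr_jacobi, h1 r s, h2 0 s, sbr_sub_right, sbr_sub_right,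
    zero_add]
  -- `e3` to `e6` evaluate the four outer brackets left over by the Jacobi identity.
  have e3 : sbr (pp x + pp y) (pp y + pp w + (pp z + pp v)) (t x y r)
      (if w = z then (-1) ^ pp w * t y v s else 0) =
      if w = z then (-1) ^ pp w * ((-1) ^ pp y * t x v (r + s) -
        if x = v then (-1) ^ pp y * t y y (r + s) else 0) else 0 := by
    split_ifs with h h'
    · subst h h'
      rw [sbr_sign_right, sbr_congr (q' := pp y + pp x) rfl (by omega), h3 rfl r s]
      simp only [if_true]
      rw [sign_congr (k := pp x * pp y + pp x * pp y + pp y * pp y) (l := pp y)]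
      rcases pp_cases y with hy | hy <;> simp [hy]; omega
    · subst h
      rw [sbr_sign_right, sbr_congr (q' := pp y + pp v) rfl (by omega), h3 rfl r s]
      simp [h']
    · simp
  have e4 : sbr (pp x + pp y) (pp y + pp w + (pp z + pp v)) (t x y r)
      (if y = v then (-1) ^ (pp y * pp w + pp y * pp z + pp w * pp z) * t z w s else 0) =
      if y = v then (-1) ^ (pp y * pp w + pp y * pp z + pp w * pp z) *
        (if y = z then (-1) ^ pp y * t x w (r + s) else 0) else 0 := by
    split_ifs with h h'
    · subst h h'
      rw [sbr_sign_right, sbr_congr (q' := pp y + pp w) rfl (by omega), h4 rfl r s]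
      simp [hxw]
    · subst h
      rw [sbr_sign_right, sbr_congr (q' := pp z + pp w) rfl (by omega), h4 rfl r s]
      simp [hxw, h']
    · simp
  have e5 : sbr (pp y + pp w) (pp x + pp y + (pp z + pp v)) (t y w 0)
      (if y = z then (-1) ^ pp y * t x v (r + s) else 0) =
      if y = z then (-1) ^ pp y * (- if y = v then (-1) ^ (pp y * pp w + pp y * pp x + pp w * pp x)
        * t x w (r + s) else 0) else 0 := by
    split_ifs with h h'
    · subst h h'
      rw [sbr_sign_right, sbr_congr (q' := pp x + pp y) rfl (by omega), h5 rfl 0 (r + s)]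
      simp [hxw.symm]
    · subst h
      rw [sbr_sign_right, sbr_congr (q' := pp x + pp v) rfl (by omega), h5 rfl 0 (r + s)]
      simp [hxw.symm, h']
    · simp
  have e6 : sbr (pp y + pp w) (pp x + pp y + (pp z + pp v)) (t y w 0)
      (if x = v then (-1) ^ (pp x * pp y + pp x * pp z + pp y * pp z) * t z y (r + s) else 0) =
      if x = v then (-1) ^ (pp x * pp y + pp x * pp z + pp y * pp z) *
        ((if w = z then (-1) ^ pp w * t y y (r + s) else 0) -
          (-1) ^ (pp y * pp w + pp y * pp z + pp w * pp z) * t z w (r + s)) else 0 := by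
    split_ifs with h h'
    · subst h h'
      rw [sbr_sign_right, sbr_congr (q' := pp w + pp y) rfl (by omega), h6 rfl 0 (r + s)]
      simp
    · subst h
      rw [sbr_sign_right, sbr_congr (q' := pp z + pp y) rfl (by omega), h6 rfl 0 (r + s)]
      simp [h']
    · simp
  rw [e3, e4, e5, e6]
  -- The terms t_yy of `e3` and `e6` cancel each other, as do the terms t_xw of `e4` and `e5`; what
  -- survives is the claimed right-hand side.
  by_cases hwz : w = z
  · subst hwz
    by_cases hxv : x = v
    · subst hxv
      simp only [hyw, if_true, if_false, hxy.symm]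
      rcases pp_cases x with hx | hx <;> rcases pp_cases y with hy | hy <;>
        rcases pp_cases w with hw | hw <;> simp [hx, hy, hw, pow_succ] <;> abel
    · simp only [hyw, hxv, if_true, if_false]
      rcases pp_cases y with hy | hy <;>
        rcases pp_cases w with hw | hw <;> simp [hy, hw, pow_succ]
  · by_cases hxv : x = v
    · subst hxv
      simp only [hwz, if_true, if_false, hxy.symm]
      rcases pp_cases x with hx | hx <;> rcases pp_cases y with hy | hy <;>
        rcases pp_cases w with hw | hw <;> rcases pp_cases z with hz | hz <;>
        simp [hx, hy, hw, hz, pow_succ]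
    · by_cases hyz : y = z
      · subst hyz
        by_cases hyv : y = v
        · subst hyv
          simp only [hwz, hxv, if_true, if_false]
          rcases pp_cases x with hx | hx <;> rcases pp_cases y with hy | hy <;>
            rcases pp_cases w with hw | hw <;> simp [hx, hy, hw, pow_succ]
        · simp [hwz, hxv, hyv]
      · simp [hwz, hxv, hyz]

/-- The mirror image of `Comm.step`, for cutting an element whose degree 0 factor stands on the
left, as for `F`. -/
theorem Comm.step_right {x y w z v : Pos μ} (hxy : x ≠ y) (hyw : y ≠ w) (hxw : x ≠ w)
    (hrec : ∀ r, t w x r = (-1) ^ pp y * sbr (pp w + pp y) (pp y + pp x) (t w y 0) (t y x r))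
    (h1 : Comm t z v y x) (h2 : Comm t z v w y)
    (h3 : w = v → Comm t z y y x) (h4 : y = z → Comm t w v y x)
    (h5 : y = v → Comm t z x w y) (h6 : x = z → Comm t y v w y) : Comm t z v w x := by
  have := Comm.step (t := transp t) (x := x) (y := y) (w := w) (z := v) (v := z) hxy hyw hxw ?_
    (comm_transp.2 h1) (comm_transp.2 h2) (fun h => comm_transp.2 (h3 h))
    (fun h => comm_transp.2 (h4 h)) (fun h => comm_transp.2 (h5 h)) (fun h => comm_transp.2 (h6 h))
  · exact comm_transp.1 this
  · intro r
    simp only [transp]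
    rw [← op_sbr, ← op_sign_mul, hrec, add_comm (pp x), add_comm (pp y) (pp w)]

end Comm


/-! ### The upper triangular part in the graded algebra -/

section Upper

variable {m n : ℕ} {μ : Fin (m + n) → ℕ+} {G : Type*} [Ring G]

/-- Induction on the distance between blocks. Any position of the preceding block may serve as the
intermediate one. -/
theorem upper_induction {x : Pos μ} {P : Pos μ → Prop} (h0 : ∀ y, blk x + 1 = blk y → P y)
    (h1 : ∀ u y, blk x < blk u → blk u + 1 = blk y → P u → P y) : ∀ y, blk x < blk y → P y := by
  suffices ∀ k y, blk y = blk x + 1 + k → P y from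
    fun y hy => this (blk y - (blk x + 1)) y (by omega)
  intro k
  induction k with
  | zero => exact fun y hy => h0 y (by omega)
  | succ k ih =>
    intro y hy
    obtain ⟨u, hu⟩ := exists_blk (w := y) (b := blk x + 1 + k) (by omega)
    exact h1 u y (by omega) (by omega) (ih u hu)

/-- The relations between the generators of the upper triangular part, together with the
definition of the other root elements. -/
structure UpperRel (t : Pos μ → Pos μ → ℕ → G) : Prop where
  two : ∀ g : G, g + g = 0 → g = 0
  split : ∀ {x y w : Pos μ} (r : ℕ), blk x < blk y → blk y + 1 = blk w →
    t x w r = (-1) ^ pp y * sbr (pp x + pp y) (pp y + pp w) (t x y r) (t y w 0)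
  same : ∀ {x y x' y' : Pos μ} (r s : ℕ), blk x + 1 = blk y → blk x' = blk x → blk y' = blk y →
    sbr (pp x + pp y) (pp x' + pp y') (t x y r) (t x' y' s) = 0
  shift : ∀ {x y w : Pos μ} (r s : ℕ), blk x + 1 = blk y → blk y + 1 = blk w →
    sbr (pp x + pp y) (pp y + pp w) (t x y (r + 1)) (t y w s) =
      sbr (pp x + pp y) (pp y + pp w) (t x y r) (t y w (s + 1))
  ne : ∀ {x y y' w : Pos μ} (r s : ℕ), blk x + 1 = blk y → blk y' = blk y →
    blk y' + 1 = blk w → y ≠ y' → sbr (pp x + pp y) (pp y' + pp w) (t x y r) (t y' w s) = 0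
  far : ∀ {x y z w : Pos μ} (r s : ℕ), blk x + 1 = blk y → blk z + 1 = blk w → blk y < blk z →
    sbr (pp x + pp y) (pp z + pp w) (t x y r) (t z w s) = 0
  serre : ∀ {x y x' y' z w : Pos μ} (r s l : ℕ), blk x + 1 = blk y → blk x' = blk x →
    blk y' = blk y → blk z + 1 = blk w → blk x ≠ blk z →
    sbr (pp x + pp y) (pp x' + pp y' + (pp z + pp w)) (t x y r)
        (sbr (pp x' + pp y') (pp z + pp w) (t x' y' s) (t z w l)) +
      sbr (pp x + pp y) (pp x' + pp y' + (pp z + pp w)) (t x y s)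
        (sbr (pp x' + pp y') (pp z + pp w) (t x' y' r) (t z w l)) = 0
  quartic : ∀ {z x y w : Pos μ} (r s : ℕ), blk z + 1 = blk x → blk x + 1 = blk y →
    blk y + 1 = blk w → blk y = m →
    sbr (pp z + pp x + (pp x + pp y)) (pp x + pp y + (pp y + pp w))
      (sbr (pp z + pp x) (pp x + pp y) (t z x r) (t x y 0))
      (sbr (pp x + pp y) (pp y + pp w) (t x y 0) (t y w s)) = 0

variable {t : Pos μ → Pos μ → ℕ → G}

theorem comm_of_zero {x y z w : Pos μ} (h1 : y ≠ z) (h2 : x ≠ w)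
    (h : ∀ r s, sbr (pp x + pp y) (pp z + pp w) (t x y r) (t z w s) = 0) : Comm t x y z w := by
  intro r s
  simp [h r s, h1, h2]

theorem Comm.eq_zero {x y z w : Pos μ} (h : Comm t x y z w) (h1 : y ≠ z) (h2 : x ≠ w) (r s : ℕ) :
    sbr (pp x + pp y) (pp z + pp w) (t x y r) (t z w s) = 0 := by
  simp [h r s, h1, h2]

theorem Comm.chain {x y w : Pos μ} (h : Comm t x y y w) (h2 : x ≠ w) (r s : ℕ) :
    sbr (pp x + pp y) (pp y + pp w) (t x y r) (t y w s) = (-1) ^ pp y * t x w (r + s) := by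
  simp [h r s, h2]

theorem Comm.split {x y w : Pos μ} (h : Comm t x y y w) (h2 : x ≠ w) (r s : ℕ) :
    t x w (r + s) = (-1) ^ pp y * sbr (pp x + pp y) (pp y + pp w) (t x y r) (t y w s) := by
  rw [h.chain h2, sign_mul_sign_mul]

/-- Taking r = s kills f r (r + l), as there is no 2-torsion. The remaining values f (k + l) k are
paired by the hypothesis with f k (k + l), which is already zero. -/
theorem eq_zero_of_antisymm (two : ∀ g : G, g + g = 0 → g = 0) {f : ℕ → ℕ → G}
    (h : ∀ r s l, f r (s + l) + f s (r + l) = 0) (r k : ℕ) : f r k = 0 := by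
  have key : ∀ r l, f r (r + l) = 0 := fun r l => two _ (h r r l)
  rcases le_total r k with hk | hk
  · obtain ⟨l, rfl⟩ := Nat.exists_eq_add_of_le hk
    exact key r l
  · obtain ⟨l, rfl⟩ := Nat.exists_eq_add_of_le hk
    have := h (k + l) k 0
    simp only [add_zero, key, add_zero] at this
    exact this

namespace UpperRel

variable (h : UpperRel t)
include h

theorem comm_far_adj {z w : Pos μ} (hzw : blk z + 1 = blk w) {x : Pos μ} :
    ∀ y, blk x < blk y → blk y < blk z → Comm t x y z w := by
  refine upper_induction (fun y hy hyz => ?_) (fun u y hu huy ih hyz => ?_)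
  · exact comm_of_zero (ne_of_blk (by omega)) (ne_of_blk (by omega))
      fun r s => h.far r s hy hzw hyz
  · have hbase : Comm t u y z w := comm_of_zero (ne_of_blk (by omega)) (ne_of_blk (by omega))
      fun r s => h.far r s huy hzw hyz
    refine Comm.step (ne_of_blk (by omega)) (ne_of_blk (by omega)) (ne_of_blk (by omega))
      (fun r => h.split r hu huy) (ih (by omega)) hbase ?_ ?_ ?_ ?_ <;>
    · rintro rfl; omega

theorem comm_far {x y z : Pos μ} (hxy : blk x < blk y) (hyz : blk y < blk z) :
    ∀ w, blk z < blk w → Comm t x y z w := by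
  refine upper_induction (fun w hw => h.comm_far_adj hw y hxy hyz) (fun u w hu huw ih => ?_)
  refine (Comm.step (ne_of_blk (by omega)) (ne_of_blk (by omega)) (ne_of_blk (by omega))
      (fun r => h.split r hu huw) ih.symm (h.comm_far_adj huw y hxy (by omega)).symm
      ?_ ?_ ?_ ?_).symm <;>
    · rintro rfl; omega

theorem comm_chain_ne_adj {z w : Pos μ} (hzw : blk z + 1 = blk w) {x : Pos μ} :
    ∀ y, blk x < blk y → blk y = blk z → y ≠ z → Comm t x y z w := by
  have hbase : ∀ {x y}, blk x + 1 = blk y → blk y = blk z → y ≠ z → Comm t x y z w :=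
    fun hy hyz hne => comm_of_zero hne (ne_of_blk (by omega))
      fun r s => h.ne r s hy hyz.symm hzw hne
  refine upper_induction (fun y hy hyz hne => hbase hy hyz hne)
    (fun u y hu huy ih hyz hne => ?_)
  refine Comm.step (ne_of_blk (by omega)) (ne_of_blk (by omega)) (ne_of_blk (by omega))
    (fun r => h.split r hu huy) (h.comm_far_adj hzw u hu (by omega)) (hbase huy hyz hne)
    (fun e => absurd e hne) ?_ ?_ ?_ <;>
  · rintro rfl; omega

/-- `shift` moves degree from the second factor to the first until the second has degree 0, where
the bracket is the definition of the root element. -/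
theorem chain_adj_adj {x y w : Pos μ} (hxy : blk x + 1 = blk y) (hyw : blk y + 1 = blk w)
    (r s : ℕ) : sbr (pp x + pp y) (pp y + pp w) (t x y r) (t y w s) =
      (-1) ^ pp y * t x w (r + s) := by
  induction s generalizing r with
  | zero => rw [h.split (r + 0) (by omega) hyw, sign_mul_sign_mul, add_zero]
  | succ s ih => rw [← h.shift r s hxy hyw, ih, add_right_comm, add_assoc]

/-- Cut t_xy at u in the block before y. Since t_xu commutes with t_yw, Jacobi turns [[t_xu^r,
t_uy^k], t_yw^s] into a bracket of t_xu^r with a multiple of t_uw^(k+s), which depends only on k +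
s. Hence s may be moved into the first factor, and the case s = 0 is the definition. -/
theorem comm_chain_eq_adj {w x : Pos μ} :
    ∀ y, blk x < blk y → blk y + 1 = blk w → Comm t x y y w := by
  have key : ∀ y, blk x < blk y → ∀ w, blk y + 1 = blk w → ∀ r s,
      sbr (pp x + pp y) (pp y + pp w) (t x y r) (t y w s) = (-1) ^ pp y * t x w (r + s) := by
    refine upper_induction (fun y hy w hyw => h.chain_adj_adj hy hyw)
      (fun u y hu huy ih w hyw r s => ?_)
    have h0 : ∀ r s, sbr (pp x + pp u) (pp y + pp w) (t x u r) (t y w s) = 0 := fun r s =>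
      (h.comm_far_adj hyw u hu (by omega)).eq_zero (ne_of_blk (by omega)) (ne_of_blk (by omega)) r s
    have hjac : ∀ k s, sbr (pp x + pp y) (pp y + pp w)
        (sbr (pp x + pp u) (pp u + pp y) (t x u r) (t u y k)) (t y w s) =
        sbr (pp x + pp u) (pp u + pp w) (t x u r) ((-1) ^ pp y * t u w (k + s)) := by
      intro k s
      rw [sbr_congr (p' := pp x + pp u + (pp u + pp y)) (by omega) rfl, sbr_jacobi, h0,
        sbr_zero_right, mul_zero, sub_zero, h.chain_adj_adj huy hyw,
        sbr_congr (q := pp u + pp y + (pp y + pp w)) (q' := pp u + pp w) rfl (by omega)]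
    rw [h.split r hu huy, sbr_sign_left, hjac, zero_add, ← add_zero s, ← hjac, ih y huy,
      sbr_sign_left, sign_mul_sign_mul, h.split (r + (s + 0)) (by omega) hyw, sign_mul_sign_mul,
      add_zero]
  intro y hxy hyw r s
  have : x ≠ w := ne_of_blk (by omega)
  simp [key y hxy w hyw r s, this]

theorem comm_chain {x u u' : Pos μ} (hxu : blk x < blk u) (hu : blk u = blk u') :
    ∀ w, blk u' < blk w → Comm t x u u' w := by
  have hbase : ∀ w, blk u' + 1 = blk w → Comm t x u u' w := by
    intro w hw
    by_cases e : u = u'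
    · subst e; exact h.comm_chain_eq_adj u hxu hw
    · exact h.comm_chain_ne_adj hw u hxu hu e
  refine upper_induction hbase (fun v w hv hvw ih => ?_)
  refine (Comm.step (ne_of_blk (by omega)) (ne_of_blk (by omega)) (ne_of_blk (by omega))
      (fun r => h.split r hv hvw) ih.symm (h.comm_far_adj hvw u hxu (by omega)).symm
      ?_ ?_ ?_ ?_).symm
  · rintro rfl; omega
  · rintro rfl; omega
  · rintro rfl; omega
  · rintro -
    exact (h.comm_chain_eq_adj v (by omega) hvw).symm

theorem split' {x u w : Pos μ} (hxu : blk x < blk u) (huw : blk u < blk w) (r : ℕ) :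
    t x w r = (-1) ^ pp u * sbr (pp x + pp u) (pp u + pp w) (t x u r) (t u w 0) :=
  (h.comm_chain hxu rfl w huw).split (ne_of_blk (by omega)) r 0

/-- By the chain relation the inner bracket of the Serre relation is a root element of degree s + l,
so the relation becomes the hypothesis of `eq_zero_of_antisymm` for f r k = [t_xy^r, t_zw^k]. -/
theorem comm_start_two {x y z u w : Pos μ} (hxy : blk x + 1 = blk y) (hz : blk z = blk x)
    (hu : blk u = blk y) (huw : blk u + 1 = blk w) : Comm t x y z w := by
  refine comm_of_zero (ne_of_blk (by omega)) (ne_of_blk (by omega)) ?_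
  refine eq_zero_of_antisymm h.two fun r s l => ?_
  have e := h.serre (z := u) (w := w) r s l hxy hz hu huw (by omega)
  have hc := (h.comm_chain (x := z) (u := u) (by omega) rfl w (by omega)).chain
    (ne_of_blk (by omega))
  rw [hc, hc, sbr_sign_right, sbr_sign_right, ← mul_add] at e
  rw [sbr_congr (q' := pp z + pp u + (pp u + pp w)) rfl (by omega),
    sbr_congr (q := pp z + pp w) (q' := pp z + pp u + (pp u + pp w)) rfl (by omega)]
  exact sign_mul_eq_zero.1 e

theorem comm_end_two {x y z u w : Pos μ} (hxy : blk x + 1 = blk y) (hw : blk w = blk y)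
    (hu : blk u = blk x) (hzu : blk z + 1 = blk u) : Comm t x y z w := by
  refine comm_of_zero (ne_of_blk (by omega)) (ne_of_blk (by omega)) ?_
  refine eq_zero_of_antisymm h.two fun r s l => ?_
  have e := h.serre (z := z) (w := u) r s l hxy hu hw hzu (by omega)
  have hc := (h.comm_chain (x := z) (u := u) (by omega) rfl w (by omega)).chain
    (ne_of_blk (by omega))
  -- Here the neighbour in the Serre relation precedes t_xy, so its inner brackets stand in the
  -- wrong order for the chain relation and are reversed first.
  rw [sbr_swap (pp u + pp w), sbr_swap (pp u + pp w), hc, hc, sbr_neg_right, sbr_neg_right,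
    sbr_sign_right, sbr_sign_right, sbr_sign_right, sbr_sign_right, ← neg_add, neg_eq_zero,
    ← mul_add, ← mul_add, add_comm l, add_comm l] at e
  rw [sbr_congr (q' := pp u + pp w + (pp z + pp u)) rfl (by omega),
    sbr_congr (q := pp z + pp w) (q' := pp u + pp w + (pp z + pp u)) rfl (by omega)]
  exact sign_mul_eq_zero.1 (sign_mul_eq_zero.1 e)

theorem comm_end {x y z w : Pos μ} (hxy : blk x + 1 = blk y) (hw : blk w = blk y)
    (hz : blk z < blk x) : Comm t x y z w := by
  obtain ⟨u, hu⟩ := exists_blk (w := x) (b := blk x) le_rfl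
  by_cases hzx : blk z + 1 = blk x
  · exact h.comm_end_two hxy hw hu (by omega)
  obtain ⟨v, hv⟩ := exists_blk (w := x) (b := blk x - 1) (by omega)
  refine (Comm.step (y := v) (ne_of_blk (by omega)) (ne_of_blk (by omega)) (ne_of_blk (by omega))
      (fun r => h.split' (by omega) (by omega) r) (h.comm_far (by omega) (by omega) y (by omega))
      (h.comm_end_two hxy hw hu (by omega)).symm ?_ ?_ ?_ ?_).symm <;>
    · rintro rfl; omega

theorem comm_start {x y z : Pos μ} (hxy : blk x + 1 = blk y) (hz : blk z = blk x) :
    ∀ w, blk y < blk w → Comm t x y z w := by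
  refine upper_induction (fun w hw => h.comm_start_two hxy hz rfl hw) (fun v w hv hvw ih => ?_)
  refine (Comm.step (y := v) (ne_of_blk (by omega)) (ne_of_blk (by omega)) (ne_of_blk (by omega))
      (fun r => h.split r (by omega) hvw) ih.symm (h.comm_far (by omega) (by omega) w (by omega)).symm
      ?_ ?_ ?_ ?_).symm <;>
    · rintro rfl; omega

/-- The bracket [t_zy, t_xw] is expanded in two ways, cutting t_xw at y (`q1`) or t_zy at x (`q2`);
both give [t_xy, t_zw] up to sign. If x and y have equal parity the two signs differ, so the bracket
vanishes. If the parities differ the two signs agree and give no information in degree 0; there the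
quartic relation is used. -/
theorem comm_inner_three {z x y w : Pos μ} (hzx : blk z + 1 = blk x) (hxy : blk x + 1 = blk y)
    (hyw : blk y + 1 = blk w) : Comm t x y z w := by
  have hzw : z ≠ w := ne_of_blk (by omega)
  have hxw : x ≠ w := ne_of_blk (by omega)
  have hyz : y ≠ z := ne_of_blk (by omega)
  have czxw := h.comm_chain (x := z) (u := x) (by omega) rfl w (by omega)
  have czxy := h.comm_chain (x := z) (u := x) (by omega) rfl y (by omega)
  have czyw := h.comm_chain (x := z) (u := y) (by omega) rfl w (by omega)
  have cxyw := h.comm_chain (x := x) (u := y) (by omega) rfl w (by omega)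
  have q1 : ∀ k s r, sbr (pp z + pp y) (pp x + pp w) (t z y k) (t x w (s + r)) =
      (-1) ^ ((pp z + pp y) * (pp x + pp y)) *
        sbr (pp x + pp y) (pp z + pp w) (t x y s) (t z w (k + r)) := by
    intro k s r
    have h0 := (h.comm_end hxy (z := z) (w := y) rfl (by omega)).symm.eq_zero
      (ne_of_blk (by omega)) (ne_of_blk (by omega)) k s
    rw [cxyw.split hxw, sbr_sign_right,
      sbr_congr (q' := pp x + pp y + (pp y + pp w)) rfl (by omega), sbr_jacobi', h0,
      sbr_zero_left, zero_add, czyw.chain hzw, sbr_sign_right,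
      sbr_congr (q := pp z + pp y + (pp y + pp w)) (q' := pp z + pp w) rfl (by omega)]
    rcases sign_cases (A := G) (pp y) with e | e <;> simp [e]
  have q2 : ∀ r q l, sbr (pp z + pp y) (pp x + pp w) (t z y (r + q)) (t x w l) =
      -((-1) ^ ((pp z + pp x) * (pp x + pp y)) *
        sbr (pp x + pp y) (pp z + pp w) (t x y q) (t z w (r + l))) := by
    intro r q l
    have h0 := (h.comm_start hxy (z := x) rfl w (by omega)).eq_zero
      (ne_of_blk (by omega)) (ne_of_blk (by omega)) q l
    rw [czxy.split (ne_of_blk (by omega)), sbr_sign_left,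
      sbr_congr (p' := pp z + pp x + (pp x + pp y)) (by omega) rfl, sbr_jacobi, h0,
      sbr_zero_right, zero_sub, czxw.chain hzw, sbr_sign_right,
      sbr_congr (q := pp z + pp x + (pp x + pp w)) (q' := pp z + pp w) rfl (by omega)]
    rcases sign_cases (A := G) (pp x) with e | e <;> simp [e]
  -- Degree 0 in t_xy comes first, because the quartic relation is available only with degree 0 in
  -- the middle factors.
  have g0 : ∀ N, sbr (pp x + pp y) (pp z + pp w) (t x y 0) (t z w N) = 0 := by
    intro N
    by_cases hm : blk y = m
    · have e := h.quartic N 0 hzx hxy hyw hm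
      rw [czxy.chain (ne_of_blk (by omega)), cxyw.chain hxw, sbr_sign_left, sbr_sign_right,
        sbr_congr (p' := pp z + pp y) (q' := pp x + pp w) (by omega) (by omega), add_zero,
        q1 N 0 0] at e
      exact sign_mul_eq_zero.1 (sign_mul_eq_zero.1 (sign_mul_eq_zero.1 e))
    · have hpar : pp x = pp y := by
        unfold pp par
        split_ifs <;> omega
      have e := (q1 N 0 0).symm.trans (q2 N 0 0)
      have h1 : (-1 : G) ^ ((pp z + pp y) * (pp x + pp y)) = 1 :=
        Even.neg_one_pow (by rw [hpar]; exact (Even.add_self _).mul_left _)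
      have h2 : (-1 : G) ^ ((pp z + pp x) * (pp x + pp y)) = 1 :=
        Even.neg_one_pow (by rw [hpar]; exact (Even.add_self _).mul_left _)
      rw [h1, h2, one_mul, add_zero, eq_neg_iff_add_eq_zero] at e
      exact h.two _ e
  -- Comparing `q1` and `q2` once more moves the degree s from t_xy to t_zw, which reduces
  -- everything to `g0`.
  refine comm_of_zero hyz hxw fun s j => ?_
  have e := (q1 j s 0).symm.trans (q2 j 0 (s + 0))
  rw [g0, mul_zero, neg_zero] at e
  exact sign_mul_eq_zero.1 e

theorem comm_inner {x y z : Pos μ} (hxy : blk x + 1 = blk y) (hz : blk z < blk x) :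
    ∀ w, blk y < blk w → Comm t x y z w := by
  refine upper_induction (fun w hw => ?_) (fun v w hv hvw ih => ?_)
  · by_cases hzx : blk z + 1 = blk x
    · exact h.comm_inner_three hzx hxy hw
    obtain ⟨v, hv⟩ := exists_blk (w := x) (b := blk x - 1) (by omega)
    refine (Comm.step (y := v) (ne_of_blk (by omega)) (ne_of_blk (by omega))
      (ne_of_blk (by omega)) (fun r => h.split' (by omega) (by omega) r)
      (h.comm_far (by omega) (by omega) y (by omega))
      (h.comm_inner_three (by omega) hxy hw).symm ?_ ?_ ?_ ?_).symm <;>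
    · rintro rfl; omega
  · refine (Comm.step (y := v) (ne_of_blk (by omega)) (ne_of_blk (by omega))
      (ne_of_blk (by omega)) (fun r => h.split r (by omega) hvw) ih.symm
      (h.comm_far (by omega) (by omega) w (by omega)).symm ?_ ?_ ?_ ?_).symm <;>
    · rintro rfl; omega

theorem comm_adj {x y z w : Pos μ} (hxy : blk x + 1 = blk y) (hzw : blk z < blk w) :
    Comm t x y z w := by
  rcases lt_trichotomy (blk w) (blk x) with hwx | hwx | hwx
  · exact (h.comm_far hzw hwx y (by omega)).symm
  · exact (h.comm_chain hzw hwx y (by omega)).symm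
  rcases eq_or_ne (blk w) (blk y) with hwy | hwy
  · rcases eq_or_ne (blk z) (blk x) with hzx | hzx
    · exact comm_of_zero (ne_of_blk (by omega)) (ne_of_blk (by omega))
        fun r s => h.same r s hxy hzx hwy
    · exact h.comm_end hxy hwy (by omega)
  rcases lt_trichotomy (blk z) (blk x) with hzx | hzx | hzx
  · exact h.comm_inner hxy hzx w (by omega)
  · exact h.comm_start hxy hzx w (by omega)
  rcases eq_or_ne (blk z) (blk y) with hzy | hzy
  · exact h.comm_chain (by omega) hzy.symm w hzw
  · exact h.comm_far (by omega) (by omega) w hzw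

/-- The commutation relations of upper triangular matrix units. -/
theorem comm {x y z w : Pos μ} (hxy : blk x < blk y) (hzw : blk z < blk w) : Comm t x y z w := by
  -- The second pair must stay general, because the outer brackets in `Comm.step` involve other
  -- pairs.
  revert z w
  refine upper_induction (P := fun y => ∀ {z w : Pos μ}, blk z < blk w → Comm t x y z w)
    (fun y hy z w hzw => h.comm_adj hy hzw) (fun u y hu huy ih z w hzw => ?_) y hxy
  refine Comm.step (ne_of_blk (by omega)) (ne_of_blk (by omega)) (ne_of_blk (by omega))
    (fun r => h.split r hu huy) (ih hzw) (h.comm_adj huy hzw) ?_ ?_ ?_ ?_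
  · rintro rfl; exact ih (by omega)
  · rintro rfl; exact ih (by omega)
  · rintro rfl; exact h.comm_adj huy (by omega)
  · rintro rfl; exact h.comm_adj huy (by omega)

end UpperRel

end Upper


/-! ### From the generators to all matrix units in the graded algebra -/

section Full

variable {m n : ℕ} {μ : Fin (m + n) → ℕ+} {G : Type*} [Ring G] {t : Pos μ → Pos μ → ℕ → G}

/-- The relations of the graded algebra: those in the upper and in the lower triangular part, and
those between the generators of the lower triangular, diagonal and upper triangular parts. -/
structure FullRel (t : Pos μ → Pos μ → ℕ → G) : Prop where
  upper : UpperRel t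
  lower : UpperRel (transp t)
  diag : ∀ {x y z w : Pos μ}, blk x = blk y → blk z = blk w → Comm t x y z w
  diag_upper : ∀ {x y z w : Pos μ}, blk x = blk y → blk z + 1 = blk w → Comm t x y z w
  diag_lower : ∀ {x y z w : Pos μ}, blk x = blk y → blk z = blk w + 1 → Comm t x y z w
  upper_lower : ∀ {x y z w : Pos μ}, blk x + 1 = blk y → blk z = blk w + 1 → Comm t x y z w

/-- Commutators of diagonal with upper triangular elements. -/
theorem UpperRel.comm_diag (h : UpperRel t)
    (hd : ∀ {x y z w : Pos μ}, blk x = blk y → blk z + 1 = blk w → Comm t x y z w)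
    {x y z w : Pos μ} (hxy : blk x < blk y) (hzw : blk z = blk w) : Comm t x y z w := by
  revert z w
  refine upper_induction (P := fun y => ∀ {z w : Pos μ}, blk z = blk w → Comm t x y z w)
    (fun y hy z w hzw => (hd hzw hy).symm) (fun u y hu huy ih z w hzw => ?_) y hxy
  refine Comm.step (ne_of_blk (by omega)) (ne_of_blk (by omega)) (ne_of_blk (by omega))
    (fun r => h.split r hu huy) (ih hzw) (hd hzw huy).symm ?_ ?_ ?_ ?_
  · rintro rfl; exact h.comm (by omega) (by omega)
  · rintro rfl; exact h.comm (by omega) (by omega)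
  · rintro rfl; exact h.comm (by omega) (by omega)
  · rintro rfl; exact h.comm (by omega) (by omega)

namespace FullRel

variable (h : FullRel t)
include h

theorem comm_upper_diag {x y z w : Pos μ} (hxy : blk x < blk y) (hzw : blk z = blk w) :
    Comm t x y z w := h.upper.comm_diag h.diag_upper hxy hzw

theorem comm_lower {x y z w : Pos μ} (hxy : blk y < blk x) (hzw : blk w < blk z) :
    Comm t x y z w := (comm_transp.1 (h.lower.comm (x := w) (y := z) (z := y) (w := x) hzw hxy))

theorem comm_lower_diag {x y z w : Pos μ} (hxy : blk y < blk x) (hzw : blk z = blk w) :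
    Comm t x y z w :=
  (comm_transp.1 (h.lower.comm_diag (fun h1 h2 => comm_transp.2 (h.diag_lower h1.symm h2.symm).symm)
    (x := y) (y := x) (z := w) (w := z) hxy hzw.symm)).symm

/-- A bracket with an adjacent lower element shifts a block number by one only. So every outer
bracket arising in `Comm.step` pairs an upper element with an upper or a diagonal one, and these
cases are already known. -/
theorem comm_upper_lower_adj {x y z w : Pos μ} (hxy : blk x < blk y) (hzw : blk z = blk w + 1) :
    Comm t x y z w := by
  have le_case : ∀ {x y z w : Pos μ}, blk x < blk y → blk z ≤ blk w → Comm t x y z w := by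
    intro x y z w h1 h2
    rcases h2.lt_or_eq with h2 | h2
    · exact h.upper.comm h1 h2
    · exact h.comm_upper_diag h1 h2
  revert z w
  refine upper_induction (P := fun y => ∀ {z w : Pos μ}, blk z = blk w + 1 → Comm t x y z w)
    (fun y hy z w hzw => h.upper_lower hy hzw) (fun u y hu huy ih z w hzw => ?_) y hxy
  refine Comm.step (ne_of_blk (by omega)) (ne_of_blk (by omega)) (ne_of_blk (by omega))
    (fun r => h.upper.split r hu huy) (ih hzw) (h.upper_lower huy hzw) ?_ ?_ ?_ ?_
  · rintro rfl; exact le_case (by omega) (by omega)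
  · rintro rfl; exact le_case (by omega) (by omega)
  · rintro rfl; exact le_case (by omega) (by omega)
  · rintro rfl; exact le_case (by omega) (by omega)

theorem comm_le_lower_adj {x y z w : Pos μ} (hzw : blk z = blk w + 1) : Comm t x y z w := by
  rcases lt_trichotomy (blk x) (blk y) with h1 | h1 | h1
  · exact h.comm_upper_lower_adj h1 hzw
  · exact h.diag_lower h1 hzw
  · exact h.comm_lower h1 (by omega)

/-- Now the lower element is cut, at u in the block before z. The outer brackets either involve the
shorter t_uw, covered by induction or by the lower–diagonal case, or the adjacent lower t_zu,
covered by `comm_le_lower_adj`. -/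
theorem comm_upper_lower {x y z w : Pos μ} (hxy : blk x < blk y) (hzw : blk w < blk z) :
    Comm t x y z w := by
  revert x y
  refine upper_induction (P := fun z => ∀ {x y : Pos μ}, blk x < blk y → Comm t x y z w)
    (fun z hz x y hxy => h.comm_upper_lower_adj hxy hz.symm) (fun u z hu huz ih x y hxy => ?_) z hzw
  have le_case : ∀ {x y : Pos μ}, blk x ≤ blk y → Comm t x y u w := by
    intro x y h2
    rcases h2.lt_or_eq with h2 | h2
    · exact ih h2
    · exact (h.comm_lower_diag hu h2).symm
  refine Comm.step_right (y := u) (ne_of_blk (by omega)) (ne_of_blk (by omega))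
    (ne_of_blk (by omega)) (fun r => ?_) (ih hxy) (h.comm_le_lower_adj (by omega)) ?_ ?_
    (fun _ => h.comm_le_lower_adj (by omega)) (fun _ => h.comm_le_lower_adj (by omega))
  · have := h.lower.split r hu huz
    simp only [transp] at this
    rw [← op_sbr, ← op_sign_mul] at this
    rw [MulOpposite.op_injective this, add_comm (pp u) (pp z), add_comm (pp w)]
  · rintro rfl; exact le_case (by omega)
  · rintro rfl; exact le_case (by omega)

/-- The commutation relations of all matrix units. -/
theorem comm (x y z w : Pos μ) : Comm t x y z w := by
  rcases lt_trichotomy (blk x) (blk y) with h1 | h1 | h1 <;>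
    rcases lt_trichotomy (blk z) (blk w) with h2 | h2 | h2
  · exact h.upper.comm h1 h2
  · exact h.comm_upper_diag h1 h2
  · exact h.comm_upper_lower h1 h2
  · exact (h.comm_upper_diag h2 h1).symm
  · exact h.diag h1 h2
  · exact (h.comm_lower_diag h2 h1).symm
  · exact (h.comm_upper_lower h2 h1).symm
  · exact h.comm_lower_diag h1 h2
  · exact h.comm_lower h1 h2

end FullRel

end Full


/-! ### The relations in the abstract algebra -/

section Relations

variable {m n : ℕ} {μ : Fin (m + n) → ℕ+}

theorem toYhat_rel {u v : FreeAlgebra ℂ (Gen μ)} (h : Rel μ u v) : toYhat μ u = toYhat μ v :=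
  RingQuot.mkAlgHom_rel ℂ h

theorem toYhat_sbr (p q : ℕ) (u v : FreeAlgebra ℂ (Gen μ)) :
    toYhat μ (sbr p q u v) = sbr p q (toYhat μ u) (toYhat μ v) :=
  map_sbr (toYhat μ).toRingHom p q u v

/-- The entries `D'_{a;i,j}^{(r)}` in the abstract algebra. -/
def yDinv (a : Fin (m + n)) (i j : Fin (μ a)) (r : ℕ) : Yhat μ := toYhat μ (fDinv a i j r)

theorem yD_zero (a : Fin (m + n)) (i j : Fin (μ a)) : yD a i j 0 = if i = j then 1 else 0 := by
  simpa only [yD, apply_ite (toYhat μ), map_one, map_zero] using toYhat_rel (Rel.D_zero a i j)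

theorem sum_yD_mul_yDinv (a : Fin (m + n)) (i j : Fin (μ a)) (r : ℕ) :
    ∑ t ∈ Finset.range (r + 1), ∑ p : Fin (μ a), yD a i p t * yDinv a p j (r - t) =
      if r = 0 ∧ i = j then 1 else 0 := by
  simpa only [yD, yDinv, apply_ite (toYhat μ), map_one, map_zero, map_sum, map_mul] using
    toYhat_rel (Rel.D_Dinv a i j r)

theorem sbr_yD_yD (a : Fin (m + n)) (i j h k : Fin (μ a)) (r s : ℕ) :
    sbr 0 0 (yD a i j r) (yD a h k s) =
      (-1) ^ par m a * ∑ t ∈ Finset.range (min r s),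
        (yD a h j t * yD a i k (r + s - 1 - t) - yD a h j (r + s - 1 - t) * yD a i k t) := by
  simpa only [yD, toYhat_sbr, map_sum, map_mul, map_sub, map_pow, map_neg, map_one] using
    toYhat_rel (Rel.D_D a i j h k r s)

theorem sbr_yD_yD_ne (a b : Fin (m + n)) (hne : a ≠ b) (i j : Fin (μ a)) (h k : Fin (μ b))
    (r s : ℕ) : sbr 0 0 (yD a i j r) (yD b h k s) = 0 := by
  simpa only [yD, toYhat_sbr, map_zero] using toYhat_rel (Rel.D_D_ne a b hne i j h k r s)

theorem sbr_yD_yE_left (a b : Fin (m + n)) (hab : a.val + 1 = b.val)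
    (i j h : Fin (μ a)) (k : Fin (μ b)) (r s : ℕ) (hs : 1 ≤ s) :
    sbr 0 (par m a + par m b) (yD a i j r) (yE a b hab h k s) =
      (-1) ^ par m a * (if h = j then
        ∑ t ∈ Finset.range r, ∑ p : Fin (μ a), yD a i p t * yE a b hab p k (r + s - 1 - t)
        else 0) := by
  simpa only [yD, yE, toYhat_sbr, map_sum, map_mul, map_sub, map_pow, map_neg, map_one,
    apply_ite (toYhat μ), map_zero] using toYhat_rel (Rel.D_E_left a b hab i j h k r s hs)

theorem sbr_yD_yE_right (a b : Fin (m + n)) (hab : a.val + 1 = b.val)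
    (i j : Fin (μ b)) (h : Fin (μ a)) (k : Fin (μ b)) (r s : ℕ) (hs : 1 ≤ s) :
    sbr 0 (par m a + par m b) (yD b i j r) (yE a b hab h k s) =
      -((-1) ^ par m b *
        ∑ t ∈ Finset.range r, yD b i k t * yE a b hab h j (r + s - 1 - t)) := by
  simpa only [yD, yE, toYhat_sbr, map_sum, map_mul, map_sub, map_pow, map_neg, map_one,
    apply_ite (toYhat μ), map_zero] using toYhat_rel (Rel.D_E_right a b hab i j h k r s hs)

theorem sbr_yD_yE_ne (c a b : Fin (m + n)) (hab : a.val + 1 = b.val) (hca : c ≠ a) (hcb : c ≠ b)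
    (i j : Fin (μ c)) (h : Fin (μ a)) (k : Fin (μ b)) (r s : ℕ) (hs : 1 ≤ s) :
    sbr 0 (par m a + par m b) (yD c i j r) (yE a b hab h k s) = 0 := by
  simpa only [yD, yE, toYhat_sbr, map_zero] using
    toYhat_rel (Rel.D_E_ne c a b hab hca hcb i j h k r s hs)

theorem sbr_yD_yF_left (a b : Fin (m + n)) (hab : a.val + 1 = b.val)
    (i j : Fin (μ a)) (h : Fin (μ b)) (k : Fin (μ a)) (r s : ℕ) (hs : 1 ≤ s) :
    sbr 0 (par m a + par m b) (yD a i j r) (yF a b hab h k s) =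
      -((-1) ^ par m a * (if k = i then
        ∑ t ∈ Finset.range r, ∑ p : Fin (μ a), yF a b hab h p (r + s - 1 - t) * yD a p j t
        else 0)) := by
  simpa only [yD, yF, toYhat_sbr, map_sum, map_mul, map_sub, map_pow, map_neg, map_one,
    apply_ite (toYhat μ), map_zero] using toYhat_rel (Rel.D_F_left a b hab i j h k r s hs)

theorem sbr_yD_yF_right (a b : Fin (m + n)) (hab : a.val + 1 = b.val)
    (i j h : Fin (μ b)) (k : Fin (μ a)) (r s : ℕ) (hs : 1 ≤ s) :
    sbr 0 (par m a + par m b) (yD b i j r) (yF a b hab h k s) =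
      (-1) ^ par m b *
        ∑ t ∈ Finset.range r, yF a b hab i k (r + s - 1 - t) * yD b h j t := by
  simpa only [yD, yF, toYhat_sbr, map_sum, map_mul, map_sub, map_pow, map_neg, map_one,
    apply_ite (toYhat μ), map_zero] using toYhat_rel (Rel.D_F_right a b hab i j h k r s hs)

theorem sbr_yD_yF_ne (c a b : Fin (m + n)) (hab : a.val + 1 = b.val) (hca : c ≠ a) (hcb : c ≠ b)
    (i j : Fin (μ c)) (h : Fin (μ b)) (k : Fin (μ a)) (r s : ℕ) (hs : 1 ≤ s) :
    sbr 0 (par m a + par m b) (yD c i j r) (yF a b hab h k s) = 0 := by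
  simpa only [yD, yF, toYhat_sbr, map_zero] using
    toYhat_rel (Rel.D_F_ne c a b hab hca hcb i j h k r s hs)

theorem sbr_yE_yE (a b : Fin (m + n)) (hab : a.val + 1 = b.val)
    (i : Fin (μ a)) (j : Fin (μ b)) (h : Fin (μ a)) (k : Fin (μ b))
    (r s : ℕ) (hr : 1 ≤ r) (hs : 1 ≤ s) :
    sbr (par m a + par m b) (par m a + par m b) (yE a b hab i j r) (yE a b hab h k s) =
      (-1) ^ par m b *
        (∑ t ∈ Finset.Ico 1 s, yE a b hab i k t * yE a b hab h j (r + s - 1 - t)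
          - ∑ t ∈ Finset.Ico 1 r, yE a b hab i k t * yE a b hab h j (r + s - 1 - t)) := by
  simpa only [yE, toYhat_sbr, map_sum, map_mul, map_sub, map_pow, map_neg, map_one] using
    toYhat_rel (Rel.E_E a b hab i j h k r s hr hs)

theorem sbr_yF_yF (a b : Fin (m + n)) (hab : a.val + 1 = b.val)
    (i : Fin (μ b)) (j : Fin (μ a)) (h : Fin (μ b)) (k : Fin (μ a))
    (r s : ℕ) (hr : 1 ≤ r) (hs : 1 ≤ s) :
    sbr (par m a + par m b) (par m a + par m b) (yF a b hab i j r) (yF a b hab h k s) =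
      (-1) ^ par m a *
        (∑ t ∈ Finset.Ico 1 r, yF a b hab i k (r + s - 1 - t) * yF a b hab h j t
          - ∑ t ∈ Finset.Ico 1 s, yF a b hab i k (r + s - 1 - t) * yF a b hab h j t) := by
  simpa only [yF, toYhat_sbr, map_sum, map_mul, map_sub, map_pow, map_neg, map_one] using
    toYhat_rel (Rel.F_F a b hab i j h k r s hr hs)

theorem sbr_yE_yF (a b : Fin (m + n)) (hab : a.val + 1 = b.val)
    (i : Fin (μ a)) (j h : Fin (μ b)) (k : Fin (μ a)) (r s : ℕ) (hr : 1 ≤ r) (hs : 1 ≤ s) :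
    sbr (par m a + par m b) (par m a + par m b) (yE a b hab i j r) (yF a b hab h k s) =
      -((-1) ^ par m b *
        ∑ t ∈ Finset.range (r + s), yD b h j (r + s - 1 - t) * yDinv a i k t) := by
  simpa only [yE, yF, yD, yDinv, toYhat_sbr, map_sum, map_mul, map_sub, map_pow, map_neg,
    map_one] using toYhat_rel (Rel.E_F a b hab i j h k r s hr hs)

theorem sbr_yE_yF_ne (a b c d : Fin (m + n)) (hab : a.val + 1 = b.val) (hcd : c.val + 1 = d.val)
    (hne : a ≠ c) (i : Fin (μ a)) (j : Fin (μ b)) (h : Fin (μ d)) (k : Fin (μ c))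
    (r s : ℕ) (hr : 1 ≤ r) (hs : 1 ≤ s) :
    sbr (par m a + par m b) (par m c + par m d) (yE a b hab i j r) (yF c d hcd h k s) = 0 := by
  simpa only [yE, yF, toYhat_sbr, map_zero] using
    toYhat_rel (Rel.E_F_ne a b c d hab hcd hne i j h k r s hr hs)

theorem sbr_yE_yE_next (a b c : Fin (m + n)) (hab : a.val + 1 = b.val) (hbc : b.val + 1 = c.val)
    (i : Fin (μ a)) (j h : Fin (μ b)) (k : Fin (μ c)) (r s : ℕ) (hr : 1 ≤ r) (hs : 1 ≤ s) :
    sbr (par m a + par m b) (par m b + par m c) (yE a b hab i j (r + 1)) (yE b c hbc h k s)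
        - sbr (par m a + par m b) (par m b + par m c) (yE a b hab i j r) (yE b c hbc h k (s + 1)) =
      (-1) ^ par m b * (if h = j then
        ∑ q : Fin (μ b), yE a b hab i q r * yE b c hbc q k s else 0) := by
  simpa only [yE, toYhat_sbr, map_sum, map_mul, map_sub, map_pow, map_neg, map_one,
    apply_ite (toYhat μ), map_zero] using toYhat_rel (Rel.E_E_next a b c hab hbc i j h k r s hr hs)

theorem sbr_yF_yF_next (a b c : Fin (m + n)) (hab : a.val + 1 = b.val) (hbc : b.val + 1 = c.val)
    (i : Fin (μ b)) (j : Fin (μ a)) (h : Fin (μ c)) (k : Fin (μ b)) (r s : ℕ)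
    (hr : 1 ≤ r) (hs : 1 ≤ s) :
    sbr (par m a + par m b) (par m b + par m c) (yF a b hab i j (r + 1)) (yF b c hbc h k s)
        - sbr (par m a + par m b) (par m b + par m c) (yF a b hab i j r) (yF b c hbc h k (s + 1)) =
      -((-1) ^ par m b * (if i = k then
        ∑ q : Fin (μ b), yF b c hbc h q s * yF a b hab q j r else 0)) := by
  simpa only [yF, toYhat_sbr, map_sum, map_mul, map_sub, map_pow, map_neg, map_one,
    apply_ite (toYhat μ), map_zero] using toYhat_rel (Rel.F_F_next a b c hab hbc i j h k r s hr hs)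

theorem sbr_yE_yE_far (a b c d : Fin (m + n)) (hab : a.val + 1 = b.val) (hcd : c.val + 1 = d.val)
    (hfar : a.val + 1 < c.val) (i : Fin (μ a)) (j : Fin (μ b)) (h : Fin (μ c)) (k : Fin (μ d))
    (r s : ℕ) (hr : 1 ≤ r) (hs : 1 ≤ s) :
    sbr (par m a + par m b) (par m c + par m d) (yE a b hab i j r) (yE c d hcd h k s) = 0 := by
  simpa only [yE, toYhat_sbr, map_zero] using
    toYhat_rel (Rel.E_E_far a b c d hab hcd hfar i j h k r s hr hs)

theorem sbr_yE_yE_ne (a b c : Fin (m + n)) (hab : a.val + 1 = b.val) (hbc : b.val + 1 = c.val)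
    (i : Fin (μ a)) (j h : Fin (μ b)) (k : Fin (μ c)) (hne : h ≠ j)
    (r s : ℕ) (hr : 1 ≤ r) (hs : 1 ≤ s) :
    sbr (par m a + par m b) (par m b + par m c) (yE a b hab i j r) (yE b c hbc h k s) = 0 := by
  simpa only [yE, toYhat_sbr, map_zero] using
    toYhat_rel (Rel.E_E_ne a b c hab hbc i j h k hne r s hr hs)

theorem sbr_yF_yF_far (a b c d : Fin (m + n)) (hab : a.val + 1 = b.val) (hcd : c.val + 1 = d.val)
    (hfar : a.val + 1 < c.val) (i : Fin (μ b)) (j : Fin (μ a)) (h : Fin (μ d)) (k : Fin (μ c))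
    (r s : ℕ) (hr : 1 ≤ r) (hs : 1 ≤ s) :
    sbr (par m a + par m b) (par m c + par m d) (yF a b hab i j r) (yF c d hcd h k s) = 0 := by
  simpa only [yF, toYhat_sbr, map_zero] using
    toYhat_rel (Rel.F_F_far a b c d hab hcd hfar i j h k r s hr hs)

theorem sbr_yF_yF_ne (a b c : Fin (m + n)) (hab : a.val + 1 = b.val) (hbc : b.val + 1 = c.val)
    (i : Fin (μ b)) (j : Fin (μ a)) (h : Fin (μ c)) (k : Fin (μ b)) (hne : i ≠ k)
    (r s : ℕ) (hr : 1 ≤ r) (hs : 1 ≤ s) :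
    sbr (par m a + par m b) (par m b + par m c) (yF a b hab i j r) (yF b c hbc h k s) = 0 := by
  simpa only [yF, toYhat_sbr, map_zero] using
    toYhat_rel (Rel.F_F_ne a b c hab hbc i j h k hne r s hr hs)

theorem yE_serre (a b c d : Fin (m + n)) (hab : a.val + 1 = b.val) (hcd : c.val + 1 = d.val)
    (hne : a ≠ c) (i : Fin (μ a)) (j : Fin (μ b)) (h : Fin (μ a)) (k : Fin (μ b))
    (f : Fin (μ c)) (g : Fin (μ d)) (r s l : ℕ) (hr : 1 ≤ r) (hs : 1 ≤ s) (hl : 1 ≤ l) :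
    sbr (par m a + par m b) (par m a + par m b + (par m c + par m d)) (yE a b hab i j r)
          (sbr (par m a + par m b) (par m c + par m d) (yE a b hab h k s) (yE c d hcd f g l))
        + sbr (par m a + par m b) (par m a + par m b + (par m c + par m d)) (yE a b hab i j s)
          (sbr (par m a + par m b) (par m c + par m d) (yE a b hab h k r) (yE c d hcd f g l)) =
      0 := by
  simpa only [yE, toYhat_sbr, map_zero, map_add] using
    toYhat_rel (Rel.E_serre a b c d hab hcd hne i j h k f g r s l hr hs hl)

theorem yF_serre (a b c d : Fin (m + n)) (hab : a.val + 1 = b.val) (hcd : c.val + 1 = d.val)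
    (hne : a ≠ c) (i : Fin (μ b)) (j : Fin (μ a)) (h : Fin (μ b)) (k : Fin (μ a))
    (f : Fin (μ d)) (g : Fin (μ c)) (r s l : ℕ) (hr : 1 ≤ r) (hs : 1 ≤ s) (hl : 1 ≤ l) :
    sbr (par m a + par m b) (par m a + par m b + (par m c + par m d)) (yF a b hab i j r)
          (sbr (par m a + par m b) (par m c + par m d) (yF a b hab h k s) (yF c d hcd f g l))
        + sbr (par m a + par m b) (par m a + par m b + (par m c + par m d)) (yF a b hab i j s)
          (sbr (par m a + par m b) (par m c + par m d) (yF a b hab h k r) (yF c d hcd f g l)) =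
      0 := by
  simpa only [yF, toYhat_sbr, map_zero, map_add] using
    toYhat_rel (Rel.F_serre a b c d hab hcd hne i j h k f g r s l hr hs hl)

theorem yE_quartic (a b c d : Fin (m + n)) (hab : a.val + 1 = b.val) (hbc : b.val + 1 = c.val)
    (hcd : c.val + 1 = d.val) (hm : b.val + 1 = m)
    (i : Fin (μ a)) (j h : Fin (μ b)) (k : Fin (μ c)) (h₀ : Fin (μ b)) (k₀ f : Fin (μ c))
    (g : Fin (μ d)) (r s : ℕ) (hr : 1 ≤ r) (hs : 1 ≤ s) :
    sbr (par m a + par m b + (par m b + par m c)) (par m b + par m c + (par m c + par m d))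
      (sbr (par m a + par m b) (par m b + par m c) (yE a b hab i j r) (yE b c hbc h k 1))
      (sbr (par m b + par m c) (par m c + par m d) (yE b c hbc h₀ k₀ 1) (yE c d hcd f g s)) =
      0 := by
  simpa only [yE, toYhat_sbr, map_zero] using
    toYhat_rel (Rel.E_quartic a b c d hab hbc hcd hm i j h k h₀ k₀ f g r s hr hs)

theorem yF_quartic (a b c d : Fin (m + n)) (hab : a.val + 1 = b.val) (hbc : b.val + 1 = c.val)
    (hcd : c.val + 1 = d.val) (hm : b.val + 1 = m)
    (i : Fin (μ b)) (j : Fin (μ a)) (h : Fin (μ c)) (k : Fin (μ b)) (h₀ : Fin (μ c))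
    (k₀ : Fin (μ b)) (f : Fin (μ d)) (g : Fin (μ c)) (r s : ℕ) (hr : 1 ≤ r) (hs : 1 ≤ s) :
    sbr (par m a + par m b + (par m b + par m c)) (par m b + par m c + (par m c + par m d))
      (sbr (par m a + par m b) (par m b + par m c) (yF a b hab i j r) (yF b c hbc h k 1))
      (sbr (par m b + par m c) (par m c + par m d) (yF b c hbc h₀ k₀ 1) (yF c d hcd f g s)) =
      0 := by
  simpa only [yF, toYhat_sbr, map_zero] using
    toYhat_rel (Rel.F_quartic a b c d hab hbc hcd hm i j h k h₀ k₀ f g r s hr hs)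

/-! ### The root elements as one family -/

theorem rootE_adj (a b : Fin (m + n)) (hab : a < b) (h : a.val + 1 = b.val) (i : Fin (μ a))
    (j : Fin (μ b)) (r : ℕ) : rootE a b hab i j r = yE a b h i j r := by
  obtain ⟨b, hb⟩ := b
  obtain rfl : a.val + 1 = b := h
  simp [rootE, rootEAux]

theorem rootF_adj (a b : Fin (m + n)) (hab : a < b) (h : a.val + 1 = b.val) (i : Fin (μ b))
    (j : Fin (μ a)) (r : ℕ) : rootF a b hab i j r = yF a b h i j r := by
  obtain ⟨b, hb⟩ := b
  obtain rfl : a.val + 1 = b := h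
  simp [rootF, rootFAux]

theorem rootE_succ (a b c : Fin (m + n)) (hab : a < b) (h : b.val + 1 = c.val) (hac : a < c)
    (i : Fin (μ a)) (j : Fin (μ c)) (r : ℕ) :
    rootE a c hac i j r = (-1) ^ par m b * sbr (par m a + par m b) (par m b + par m c)
      (rootE a b hab i ⟨0, (μ b).pos⟩ r) (yE b c h ⟨0, (μ b).pos⟩ j 1) := by
  obtain ⟨c, hc⟩ := c
  obtain rfl : b.val + 1 = c := h
  have : a.val ≠ b.val := ne_of_lt hab
  simp [rootE, rootEAux, this]

theorem rootF_succ (a b c : Fin (m + n)) (hab : a < b) (h : b.val + 1 = c.val) (hac : a < c)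
    (i : Fin (μ c)) (j : Fin (μ a)) (r : ℕ) :
    rootF a c hac i j r = (-1) ^ par m b * sbr (par m b + par m c) (par m a + par m b)
      (yF b c h i ⟨0, (μ b).pos⟩ 1) (rootF a b hab ⟨0, (μ b).pos⟩ j r) := by
  obtain ⟨c, hc⟩ := c
  obtain rfl : b.val + 1 = c := h
  have : a.val ≠ b.val := ne_of_lt hab
  simp [rootF, rootFAux, this]

/-- The elements `E`, `F`, `D` of upper index `r + 1` as one family, indexed by pairs of
positions. -/
def tri (x y : Pos μ) (r : ℕ) : Yhat μ :=
  if h : x.1 < y.1 then rootE x.1 y.1 h x.2 y.2 (r + 1)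
  else if h' : y.1 < x.1 then rootF y.1 x.1 h' x.2 y.2 (r + 1)
  else yD x.1 x.2 (Fin.cast (by rw [le_antisymm (not_lt.1 h) (not_lt.1 h')]) y.2) (r + 1)

theorem tri_upper {x y : Pos μ} (h : x.1 < y.1) (r : ℕ) :
    tri x y r = rootE x.1 y.1 h x.2 y.2 (r + 1) := by simp [tri, h]

theorem tri_lower {x y : Pos μ} (h : y.1 < x.1) (r : ℕ) :
    tri x y r = rootF y.1 x.1 h x.2 y.2 (r + 1) := by simp [tri, h, h.not_gt]

theorem tri_diag (a : Fin (m + n)) (i j : Fin (μ a)) (r : ℕ) :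
    tri ⟨a, i⟩ ⟨a, j⟩ r = yD a i j (r + 1) := by simp [tri]

theorem tri_E {x y : Pos μ} (h : blk x + 1 = blk y) (r : ℕ) :
    tri x y r = yE x.1 y.1 h x.2 y.2 (r + 1) := by
  have : x.1 < y.1 := Fin.lt_def.2 (by unfold blk at h; omega)
  rw [tri_upper this]
  exact rootE_adj _ _ this h _ _ _

theorem tri_F {x y : Pos μ} (h : blk y + 1 = blk x) (r : ℕ) :
    tri x y r = yF y.1 x.1 h x.2 y.2 (r + 1) := by
  have : y.1 < x.1 := Fin.lt_def.2 (by unfold blk at h; omega)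
  rw [tri_lower this]
  exact rootF_adj _ _ this h _ _ _

theorem tri_mk_E {a b : Fin (m + n)} (h : a.val + 1 = b.val) (i : Fin (μ a)) (j : Fin (μ b))
    (r : ℕ) : tri ⟨a, i⟩ ⟨b, j⟩ r = yE a b h i j (r + 1) :=
  tri_E (x := ⟨a, i⟩) (y := ⟨b, j⟩) h r

theorem tri_mk_F {a b : Fin (m + n)} (h : a.val + 1 = b.val) (i : Fin (μ b)) (j : Fin (μ a))
    (r : ℕ) : tri ⟨b, i⟩ ⟨a, j⟩ r = yF a b h i j (r + 1) :=
  tri_F (x := ⟨b, i⟩) (y := ⟨a, j⟩) h r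

theorem exists_same {a : Fin (m + n)} {i : Fin (μ a)} {x : Pos μ} (h : blk x = blk ⟨a, i⟩) :
    ∃ j, x = ⟨a, j⟩ := by
  obtain ⟨b, j⟩ := x
  obtain rfl : b = a := Fin.ext h
  exact ⟨j, rfl⟩

end Relations


/-! ### Independence of the root elements of the intermediate index -/

section Independence

variable {m n : ℕ} {μ : Fin (m + n) → ℕ+} {A : Type*} [Ring A] {t : Pos μ → Pos μ → ℕ → A}

theorem exists_base {w : Pos μ} {b : ℕ} (h : b ≤ blk w) :
    ∃ y : Pos μ, blk y = b ∧ y.2.val = 0 :=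
  ⟨⟨⟨b, h.trans_lt w.1.isLt⟩, ⟨0, (μ _).pos⟩⟩, rfl, rfl⟩

/-- The root elements are defined with the first index of the intermediate block. Before
independence is known, inductive arguments may cut only there. -/
theorem upper_induction_base {x : Pos μ} {P : Pos μ → Prop} (h0 : ∀ y, blk x + 1 = blk y → P y)
    (h1 : ∀ u y, u.2.val = 0 → blk x < blk u → blk u + 1 = blk y → P u → P y) :
    ∀ y, blk x < blk y → P y := by
  -- The property is carried for the whole block of y, so that it is available at the first index of
  -- the block in the next step.
  have key : ∀ y : Pos μ, blk x < blk y → ∀ y' : Pos μ, blk y' = blk y → P y' := by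
    refine upper_induction (fun y hy y' hy' => h0 y' (by omega)) (fun u y hu huy ih y' hy' => ?_)
    obtain ⟨v, hv, hv0⟩ := exists_base (w := u) le_rfl
    exact h1 v y' hv0 (by omega) (by omega) (ih v hv)
  exact fun y hy => key y hy y rfl

/-- The relations in the algebra itself which show that the root elements do not depend on the
intermediate index. -/
structure RootRel (t : Pos μ → Pos μ → ℕ → A) : Prop where
  base : ∀ {x y w : Pos μ} (r : ℕ), y.2.val = 0 → blk x < blk y → blk y + 1 = blk w →
    t x w r = (-1) ^ pp y * sbr (pp x + pp y) (pp y + pp w) (t x y r) (t y w 0)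
  ne : ∀ {x y y' w : Pos μ} (r s : ℕ), blk x + 1 = blk y → blk y' = blk y →
    blk y' + 1 = blk w → y ≠ y' → sbr (pp x + pp y) (pp y' + pp w) (t x y r) (t y' w s) = 0
  far : ∀ {x y z w : Pos μ} (r s : ℕ), blk x + 1 = blk y → blk z + 1 = blk w → blk y < blk z →
    sbr (pp x + pp y) (pp z + pp w) (t x y r) (t z w s) = 0
  diag : ∀ {u v x y : Pos μ} (r : ℕ), blk u = blk v → blk x + 1 = blk y →
    sbr (pp u + pp v) (pp x + pp y) (t u v 0) (t x y r) =
      (if v = x then (-1) ^ pp v * t u y r else 0) - (if u = y then (-1) ^ pp v * t x v r else 0)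

namespace RootRel

variable (h : RootRel t)
include h

theorem comm_far_adj {z w : Pos μ} (hzw : blk z + 1 = blk w) {x : Pos μ} :
    ∀ y, blk x < blk y → blk y < blk z → Comm t x y z w := by
  refine upper_induction_base (fun y hy hyz => ?_) (fun u y hu0 hu huy ih hyz => ?_)
  · exact comm_of_zero (ne_of_blk (by omega)) (ne_of_blk (by omega))
      fun r s => h.far r s hy hzw hyz
  · have hbase : Comm t u y z w := comm_of_zero (ne_of_blk (by omega)) (ne_of_blk (by omega))
      fun r s => h.far r s huy hzw hyz
    refine Comm.step (ne_of_blk (by omega)) (ne_of_blk (by omega)) (ne_of_blk (by omega))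
      (fun r => h.base r hu0 hu huy) (ih (by omega)) hbase ?_ ?_ ?_ ?_ <;>
    · rintro rfl; omega

theorem comm_chain_ne_adj {z w : Pos μ} (hzw : blk z + 1 = blk w) {x : Pos μ} :
    ∀ y, blk x < blk y → blk y = blk z → y ≠ z → Comm t x y z w := by
  have hbase : ∀ {x y}, blk x + 1 = blk y → blk y = blk z → y ≠ z → Comm t x y z w :=
    fun hy hyz hne => comm_of_zero hne (ne_of_blk (by omega))
      fun r s => h.ne r s hy hyz.symm hzw hne
  refine upper_induction_base (fun y hy hyz hne => hbase hy hyz hne)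
    (fun u y hu0 hu huy ih hyz hne => ?_)
  refine Comm.step (ne_of_blk (by omega)) (ne_of_blk (by omega)) (ne_of_blk (by omega))
    (fun r => h.base r hu0 hu huy) (h.comm_far_adj hzw u hu (by omega)) (hbase huy hyz hne)
    (fun e => absurd e hne) ?_ ?_ ?_ <;>
  · rintro rfl; omega

theorem diag_far {u v x : Pos μ} (huv : blk u = blk v) : ∀ y, blk x < blk y → blk y < blk u →
    ∀ r, sbr (pp u + pp v) (pp x + pp y) (t u v 0) (t x y r) = 0 := by
  have hbase : ∀ {x y : Pos μ}, blk x + 1 = blk y → blk y < blk u →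
      ∀ r, sbr (pp u + pp v) (pp x + pp y) (t u v 0) (t x y r) = 0 := by
    intro x y hxy hyu r
    have h1 : v ≠ x := ne_of_blk (by omega)
    have h2 : u ≠ y := ne_of_blk (by omega)
    simp [h.diag r huv hxy, h1, h2]
  refine upper_induction_base (fun y hy hyu => hbase hy hyu) (fun a y ha0 hxa hay ih hyu r => ?_)
  rw [h.base r ha0 hxa hay, sbr_sign_right,
    sbr_congr (q' := pp x + pp a + (pp a + pp y)) rfl (by omega), sbr_jacobi',
    ih (by omega), hbase hay hyu]
  simp

/-- The element t_uv acts as a derivation. In the bracket that defines t_xy it kills the first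
factor, which ends before the block of u, and replaces only the column of the last factor. -/
theorem diag_end {u v x : Pos μ} (huv : blk u = blk v) : ∀ y, blk x < blk y → blk y = blk u →
    ∀ r, sbr (pp u + pp v) (pp x + pp y) (t u v 0) (t x y r) =
      - if u = y then (-1) ^ pp v * t x v r else 0 := by
  have hbase : ∀ {x y : Pos μ}, blk x + 1 = blk y → blk y = blk u →
      ∀ r, sbr (pp u + pp v) (pp x + pp y) (t u v 0) (t x y r) =
      - if u = y then (-1) ^ pp v * t x v r else 0 := by
    intro x y hxy hyu r
    have h1 : v ≠ x := ne_of_blk (by omega)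
    simp [h.diag r huv hxy, h1]
  refine upper_induction_base (fun y hy hyu => hbase hy hyu) (fun a y ha0 hxa hay ih hyu r => ?_)
  have hp : (-1 : A) ^ ((pp u + pp v) * (pp x + pp a)) = 1 :=
    Even.neg_one_pow (by rw [pp_congr huv]; exact (Even.add_self _).mul_right _)
  rw [h.base r ha0 hxa hay, sbr_sign_right,
    sbr_congr (q' := pp x + pp a + (pp a + pp y)) rfl (by omega), sbr_jacobi',
    h.diag_far huv a hxa (by omega), hbase hay hyu, hp, sbr_zero_left, zero_add, one_mul]
  split_ifs with e
  · subst e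
    rw [h.base (w := v) r ha0 hxa (by omega), sbr_neg_right, sbr_sign_right,
      sbr_congr (q := pp u + pp v + (pp a + pp u)) (q' := pp a + pp v) rfl (by omega), mul_neg,
      ← mul_assoc, ← mul_assoc, ← pow_add, ← pow_add, add_comm (pp a)]
  · simp

/-- The root elements do not depend on the intermediate index. -/
theorem split {x y w : Pos μ} (hxy : blk x < blk y) (hyw : blk y + 1 = blk w) (r : ℕ) :
    t x w r = (-1) ^ pp y * sbr (pp x + pp y) (pp y + pp w) (t x y r) (t y w 0) := by
  obtain ⟨z, hz, hz0⟩ := exists_base (w := y) le_rfl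
  by_cases e : y = z
  · subst e; exact h.base r hz0 hxy hyw
  have h0 := (h.comm_chain_ne_adj (w := w) (by omega) y hxy hz.symm e).eq_zero e
    (ne_of_blk (by omega)) r 0
  have hp : (-1 : A) ^ ((pp y + pp z) * (pp x + pp y)) = 1 :=
    Even.neg_one_pow (by rw [pp_congr hz]; exact (Even.add_self _).mul_right _)
  -- The bracket [t_xy, t_zw] vanishes. Applying t_yz to it turns t_xy into -t_xz and t_zw into t_yw
  -- up to one common sign, which equates the expressions with intermediate index z and y.
  have hj := sbr_jacobi' (pp y + pp z) (pp x + pp y) (pp z + pp w) (t y z 0) (t x y r) (t z w 0)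
  have h1 : z ≠ x := ne_of_blk (by omega)
  have h2 : y ≠ w := ne_of_blk (by omega)
  rw [h0, sbr_zero_right, h.diag_end hz.symm y hxy rfl, h.diag 0 hz.symm (by omega), hp] at hj
  simp only [if_true, h2, if_false, sub_zero, one_mul] at hj
  rw [sbr_neg_left, sbr_sign_left, sbr_sign_right, ← mul_neg, ← mul_add, eq_comm,
    sign_mul_eq_zero, neg_add_eq_zero,
    sbr_congr (p := pp y + pp z + (pp x + pp y)) (p' := pp x + pp z) (by omega) rfl,
    sbr_congr (q := pp y + pp z + (pp z + pp w)) (q' := pp y + pp w) rfl (by omega)] at hj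
  rw [h.base (y := z) r hz0 (by omega) (by omega), hj, pp_congr hz]

end RootRel

end Independence

/-! ### The independence relations for `E` and, transposed, for `F` -/

section Instances

variable {m n : ℕ} {μ : Fin (m + n) → ℕ+}

theorem pp_mk (a : Fin (m + n)) (i : Fin (μ a)) : pp (⟨a, i⟩ : Pos μ) = par m a := rfl

theorem sbr_diag_congr {A : Type*} [Ring A] (p q : ℕ) (x y : A) :
    sbr (p + p) q x y = sbr 0 q x y := sbr_congr (by omega) rfl x y

theorem rootRel_tri : RootRel (tri (μ := μ)) where
  base := by
    rintro ⟨a, i⟩ ⟨b, k⟩ ⟨c, j⟩ r hk hab hbc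
    obtain rfl : k = ⟨0, (μ b).pos⟩ := Fin.ext hk
    have hac : a < c := Fin.lt_def.2 (by simp only [blk] at hab hbc; omega)
    rw [tri_upper (x := ⟨a, i⟩) (y := ⟨b, _⟩) hab, tri_E hbc, tri_upper hac]
    exact rootE_succ a b c hab hbc hac i j (r + 1)
  ne := by
    rintro ⟨a, i⟩ ⟨b, j⟩ y' ⟨c, k⟩ r s hab hb hbc hne
    obtain ⟨h, rfl⟩ := exists_same hb
    rw [tri_E hab, tri_E hbc]
    exact sbr_yE_yE_ne a b c hab hbc i j h k (fun e => hne (by rw [e])) _ _ (by omega) (by omega)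
  far := by
    rintro ⟨a, i⟩ ⟨b, j⟩ ⟨c, h⟩ ⟨d, k⟩ r s hab hcd hbc
    rw [tri_E hab, tri_E hcd]
    exact sbr_yE_yE_far a b c d hab hcd (by simp only [blk] at *; omega) i j h k _ _
      (by omega) (by omega)
  diag := by
    rintro ⟨a, i⟩ v ⟨b, h⟩ ⟨c, k⟩ r hv hbc
    obtain ⟨j, rfl⟩ := exists_same hv.symm
    have e := fun (i : Fin (μ b)) (k : Fin (μ c)) => tri_mk_E (a := b) (b := c) hbc i k r
    rw [tri_diag, tri_E hbc, pp_mk, pp_mk, pp_mk, pp_mk, sbr_diag_congr]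
    -- The upper index of `D` is 1, so each sum over t has the single term t = 0, where D^{(0)} = δ.
    -- The relation is therefore linear without passing to the graded algebra.
    by_cases hab : a = b
    · subst hab
      have hac : a ≠ c := fun e => by subst e; simp [blk] at hbc
      rw [sbr_yD_yE_left a c hbc _ _ _ _ _ _ (by omega)]
      simp [yD_zero, e, hac, eq_comm (a := h)]
    by_cases hac : a = c
    · subst hac
      rw [sbr_yD_yE_right b a hbc _ _ _ _ _ _ (by omega)]
      simp [yD_zero, e, hab]
    · rw [sbr_yD_yE_ne a b c hbc hab hac _ _ _ _ _ _ (by omega)]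
      simp [hab, hac]

theorem rootRel_transp_tri : RootRel (transp (tri (μ := μ))) where
  base := by
    rintro ⟨a, i⟩ ⟨b, k⟩ ⟨c, j⟩ r hk hab hbc
    obtain rfl : k = ⟨0, (μ b).pos⟩ := Fin.ext hk
    have hac : a < c := Fin.lt_def.2 (by simp only [blk] at hab hbc; omega)
    simp only [transp]
    rw [tri_lower (y := ⟨a, i⟩) (x := ⟨b, _⟩) hab, tri_F hbc, tri_lower hac, ← op_sbr, ← op_sign_mul]
    exact congrArg _ (rootF_succ a b c hab hbc hac j i (r + 1))
  ne := by
    rintro ⟨a, i⟩ ⟨b, j⟩ y' ⟨c, k⟩ r s hab hb hbc hne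
    obtain ⟨h, rfl⟩ := exists_same hb
    simp only [transp]
    rw [tri_F hab, tri_F hbc, ← op_sbr, MulOpposite.op_eq_zero_iff]
    exact sbr_eq_zero_comm (sbr_yF_yF_ne a b c hab hbc j i k h (fun e => hne (by rw [e])) _ _
      (by omega) (by omega))
  far := by
    rintro ⟨a, i⟩ ⟨b, j⟩ ⟨c, h⟩ ⟨d, k⟩ r s hab hcd hbc
    simp only [transp]
    rw [tri_F hab, tri_F hcd, ← op_sbr, MulOpposite.op_eq_zero_iff]
    exact sbr_eq_zero_comm (sbr_yF_yF_far a b c d hab hcd (by simp only [blk] at *; omega) j i k h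
      _ _ (by omega) (by omega))
  diag := by
    rintro ⟨a, i⟩ v ⟨b, h⟩ ⟨c, k⟩ r hv hbc
    obtain ⟨j, rfl⟩ := exists_same hv.symm
    have e := fun (i : Fin (μ c)) (k : Fin (μ b)) => tri_mk_F (a := b) (b := c) hbc i k r
    simp only [transp]
    rw [tri_diag, tri_F hbc, pp_mk, pp_mk, pp_mk, pp_mk, sbr_diag_congr, ← op_sbr,
      sbr_swap, mul_zero, pow_zero, one_mul]
    by_cases hab : a = b
    · subst hab
      have hac : a ≠ c := fun e => by subst e; simp [blk] at hbc
      rw [sbr_yD_yF_left a c hbc _ _ _ _ _ _ (by omega)]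
      by_cases hj : j = h <;> simp [yD_zero, e, hac, hj, eq_comm (a := h), op_sign_mul, -MulOpposite.op_mul]
    by_cases hac : a = c
    · subst hac
      rw [sbr_yD_yF_right b a hbc _ _ _ _ _ _ (by omega)]
      by_cases hk : i = k <;> simp [yD_zero, e, hab, hk, eq_comm (a := k), op_sign_mul, -MulOpposite.op_mul]
    · rw [sbr_yD_yF_ne a b c hbc hab hac _ _ _ _ _ _ (by omega)]
      simp [hab, hac]

end Instances


/-! ### Symbols of elements of a filtered algebra -/

section Symbol

variable {A G : Type*} [Ring A] [Ring G]

/-- A relation `S k a g`, to be read as: `a` lies in the `k`-th term of a filtration of `A`, and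
its class in the degree `k` component of the graded algebra is `g`. -/
structure Symbol (S : ℕ → A → G → Prop) : Prop where
  zero : ∀ k, S k 0 0
  add : ∀ {k a b g h}, S k a g → S k b h → S k (a + b) (g + h)
  neg : ∀ {k a g}, S k a g → S k (-a) (-g)
  mul : ∀ {k l a b g h}, S k a g → S l b h → S (k + l) (a * b) (g * h)
  lower : ∀ {k l a g}, S k a g → k < l → S l a 0
  uniq : ∀ {k a g h}, S k a g → S k a h → g = h

namespace Symbol

variable {S : ℕ → A → G → Prop} (hS : Symbol S)
include hS

theorem sub {k a b g h} (h1 : S k a g) (h2 : S k b h) : S k (a - b) (g - h) := by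
  rw [sub_eq_add_neg, sub_eq_add_neg]
  exact hS.add h1 (hS.neg h2)

theorem sign {k a g} (l : ℕ) (h : S k a g) : S k ((-1) ^ l * a) ((-1) ^ l * g) := by
  rcases Nat.even_or_odd l with hl | hl
  · simpa [hl.neg_one_pow] using h
  · simpa [hl.neg_one_pow] using hS.neg h

theorem sign_zero {k a} (l : ℕ) (h : S k a 0) : S k ((-1) ^ l * a) 0 := by
  simpa using hS.sign l h

theorem ite {k a g} (c : Prop) [Decidable c] (h : S k a g) :
    S k (if c then a else 0) (if c then g else 0) := by
  split_ifs
  · exact h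
  · exact hS.zero k

theorem ite_zero {k a} (c : Prop) [Decidable c] (h : S k a 0) : S k (if c then a else 0) 0 := by
  split_ifs
  · exact h
  · exact hS.zero k

theorem sum_zero {k : ℕ} {ι : Type*} (s : Finset ι) (f : ι → A) (h : ∀ i ∈ s, S k (f i) 0) :
    S k (∑ i ∈ s, f i) 0 := by
  classical
  induction s using Finset.induction_on with
  | empty => simpa using hS.zero k
  | insert i s hi ih =>
    rw [Finset.sum_insert hi, ← add_zero (0 : G)]
    exact hS.add (h i (Finset.mem_insert_self i s))
      (ih fun j hj => h j (Finset.mem_insert_of_mem hj))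

theorem lower_add {k a b g} (h1 : S k a 0) (h2 : S k b g) : S k (a + b) g := by
  simpa using hS.add h1 h2

theorem neg_zero {k a} (h : S k a 0) : S k (-a) 0 := by
  simpa using hS.neg h

theorem sub_zero {k a b} (h1 : S k a 0) (h2 : S k b 0) : S k (a - b) 0 := by
  simpa using hS.sub h1 h2

theorem mul_lower {k l d a b g h} (h1 : S k a g) (h2 : S l b h) (hd : k + l < d) :
    S d (a * b) 0 := hS.lower (hS.mul h1 h2) hd

theorem sbr {k l a b g h} (p q : ℕ) (h1 : S k a g) (h2 : S l b h) :
    S (k + l) (sbr p q a b) (sbr p q g h) :=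
  hS.sub (hS.mul h1 h2) (hS.sign _ (by rw [add_comm]; exact hS.mul h2 h1))

theorem eq_zero {k a g} (h : S k a g) (h0 : a = 0) : g = 0 :=
  hS.uniq h (h0 ▸ hS.zero k)

end Symbol

end Symbol

/-! ### The relations of the triangular halves in top degree -/

section Triangular

variable {m n : ℕ} {μ : Fin (m + n) → ℕ+} {G : Type*} [Ring G] {t : Pos μ → Pos μ → ℕ → G}
  {S : ℕ → Yhat μ → G → Prop}

/-- The relations between the symbols of the elements `E`. -/
theorem Symbol.upperRel (hS : Symbol S) (two : ∀ g : G, g + g = 0 → g = 0)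
    (hE : ∀ {x y : Pos μ} (r : ℕ), blk x < blk y → S r (tri x y r) (t x y r)) : UpperRel t := by
  have hE1 : ∀ {x y : Pos μ} (r : ℕ), blk x + 1 = blk y → S r (tri x y r) (t x y r) :=
    fun r h => hE r (by omega)
  have hEr : ∀ {a b : Fin (m + n)} (hab : a.val + 1 = b.val) (i : Fin (μ a)) (j : Fin (μ b))
      (r : ℕ), 1 ≤ r → S (r - 1) (yE a b hab i j r) (t ⟨a, i⟩ ⟨b, j⟩ (r - 1)) := by
    intro a b hab i j r hr
    obtain ⟨r, rfl⟩ := Nat.exists_eq_add_of_le' hr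
    rw [← tri_mk_E hab]
    exact hE1 r hab
  refine ⟨two, ?_, ?_, ?_, ?_, ?_, ?_, ?_⟩
  · intro x y w r hxy hyw
    refine hS.uniq (hE r (by omega)) ?_
    rw [rootRel_tri.split hxy hyw r]
    exact hS.sign _ (hS.sbr _ _ (hE r hxy) (hE1 0 hyw))
  · rintro ⟨a, i⟩ ⟨b, j⟩ x' y' r s hab hx hy
    obtain ⟨h, rfl⟩ := exists_same hx
    obtain ⟨k, rfl⟩ := exists_same hy
    refine hS.uniq (hS.sbr _ _ (hE1 r hab) (hE1 s hab)) ?_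
    rw [tri_mk_E hab, tri_mk_E hab]
    simp only [pp_mk]
    rw [sbr_yE_yE a b hab i j h k _ _ (by omega) (by omega)]
    refine hS.sign_zero _ (hS.sub_zero (hS.sum_zero _ _ fun u hu => ?_)
      (hS.sum_zero _ _ fun u hu => ?_)) <;>
    · rw [Finset.mem_Ico] at hu
      -- The upper indices of the factors add up to r + s + 1, so the product has degree r + s - 1,
      -- below the top degree r + s.
      exact hS.mul_lower (hEr hab _ _ _ (by omega)) (hEr hab _ _ _ (by omega)) (by omega)
  · rintro ⟨a, i⟩ ⟨b, j⟩ ⟨c, k⟩ r s hab hbc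
    have h1 := hS.sbr (pp ⟨a, i⟩ + pp ⟨b, j⟩) (pp ⟨b, j⟩ + pp ⟨c, k⟩) (hE1 (r + 1) hab) (hE1 s hbc)
    have h2 := hS.sbr (pp ⟨a, i⟩ + pp ⟨b, j⟩) (pp ⟨b, j⟩ + pp ⟨c, k⟩) (hE1 r hab) (hE1 (s + 1) hbc)
    rw [show r + (s + 1) = r + 1 + s by omega] at h2
    refine sub_eq_zero.1 (hS.uniq (hS.sub h1 h2) ?_)
    rw [tri_mk_E hab, tri_mk_E hab, tri_mk_E hbc, tri_mk_E hbc]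
    simp only [pp_mk]
    rw [sbr_yE_yE_next a b c hab hbc i j j k _ _ (by omega) (by omega)]
    refine hS.sign_zero _ (hS.ite_zero _ (hS.sum_zero _ _ fun u _ => ?_))
    exact hS.mul_lower (hEr hab _ _ _ (by omega)) (hEr hbc _ _ _ (by omega)) (by omega)
  · intro x y y' w r s hxy hy hyw hne
    exact hS.eq_zero (hS.sbr _ _ (hE1 r hxy) (hE1 s hyw)) (rootRel_tri.ne r s hxy hy hyw hne)
  · intro x y z w r s hxy hzw hyz
    exact hS.eq_zero (hS.sbr _ _ (hE1 r hxy) (hE1 s hzw)) (rootRel_tri.far r s hxy hzw hyz)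
  · rintro ⟨a, i⟩ ⟨b, j⟩ x' y' ⟨c, f⟩ ⟨d, g⟩ r s l hab hx hy hcd hne
    obtain ⟨h, rfl⟩ := exists_same hx
    obtain ⟨k, rfl⟩ := exists_same hy
    have h1 := hS.sbr (pp ⟨a, i⟩ + pp ⟨b, j⟩) (pp ⟨a, h⟩ + pp ⟨b, k⟩ + (pp ⟨c, f⟩ + pp ⟨d, g⟩))
      (hE1 (x := ⟨a, i⟩) (y := ⟨b, j⟩) r hab) (hS.sbr (pp ⟨a, h⟩ + pp ⟨b, k⟩)
      (pp ⟨c, f⟩ + pp ⟨d, g⟩) (hE1 (x := ⟨a, h⟩) (y := ⟨b, k⟩) s hab) (hE1 l hcd))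
    have h2 := hS.sbr (pp ⟨a, i⟩ + pp ⟨b, j⟩) (pp ⟨a, h⟩ + pp ⟨b, k⟩ + (pp ⟨c, f⟩ + pp ⟨d, g⟩))
      (hE1 (x := ⟨a, i⟩) (y := ⟨b, j⟩) s hab) (hS.sbr (pp ⟨a, h⟩ + pp ⟨b, k⟩)
      (pp ⟨c, f⟩ + pp ⟨d, g⟩) (hE1 (x := ⟨a, h⟩) (y := ⟨b, k⟩) r hab) (hE1 l hcd))
    rw [show s + (r + l) = r + (s + l) by omega] at h2
    refine hS.eq_zero (hS.add h1 h2) ?_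
    rw [tri_mk_E hab, tri_mk_E hab, tri_mk_E hab, tri_mk_E hab, tri_mk_E hcd]
    exact yE_serre a b c d hab hcd (fun e => hne (congrArg Fin.val e)) i j h k f g _ _ _
      (by omega) (by omega) (by omega)
  · rintro ⟨a, i⟩ ⟨b, j⟩ ⟨c, k⟩ ⟨d, l⟩ r s hab hbc hcd hm
    refine hS.eq_zero (hS.sbr _ _ (hS.sbr _ _ (hE1 r hab) (hE1 0 hbc))
      (hS.sbr _ _ (hE1 0 hbc) (hE1 s hcd))) ?_
    rw [tri_mk_E hab, tri_mk_E hbc, tri_mk_E hcd]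
    exact yE_quartic a b c d hab hbc hcd (by simp only [blk] at *; omega) _ _ _ _ _ _ _ _ _ _
      (by omega) (by omega)

/-- The relations between the symbols of the elements `F`. -/
theorem Symbol.lowerRel (hS : Symbol S) (two : ∀ g : G, g + g = 0 → g = 0)
    (hF : ∀ {x y : Pos μ} (r : ℕ), blk y < blk x → S r (tri x y r) (t x y r)) :
    UpperRel (transp t) := by
  have hF1 : ∀ {x y : Pos μ} (r : ℕ), blk y + 1 = blk x → S r (tri x y r) (t x y r) :=
    fun r h => hF r (by omega)
  have hFr : ∀ {a b : Fin (m + n)} (hab : a.val + 1 = b.val) (i : Fin (μ b)) (j : Fin (μ a))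
      (r : ℕ), 1 ≤ r → S (r - 1) (yF a b hab i j r) (t ⟨b, i⟩ ⟨a, j⟩ (r - 1)) := by
    intro a b hab i j r hr
    obtain ⟨r, rfl⟩ := Nat.exists_eq_add_of_le' hr
    rw [← tri_mk_F hab]
    exact hF1 r hab
  refine ⟨fun g hg => MulOpposite.unop_injective (two _ (congrArg MulOpposite.unop hg)),
    ?_, ?_, ?_, ?_, ?_, ?_, ?_⟩
  · intro x y w r hxy hyw
    have e := rootRel_transp_tri.split hxy hyw r
    simp only [transp] at e ⊢
    rw [← op_sbr, ← op_sign_mul, MulOpposite.op_inj] at e ⊢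
    refine hS.uniq (hF r (by omega)) ?_
    -- In the recursion for `F` the factor of degree 0 stands first, so the degree of the bracket
    -- appears as 0 + r.
    rw [e, ← zero_add r]
    exact hS.sign _ (hS.sbr _ _ (hF1 0 hyw) (by rw [zero_add]; exact hF r hxy))
  · rintro ⟨a, i⟩ ⟨b, j⟩ x' y' r s hab hx hy
    obtain ⟨h, rfl⟩ := exists_same hx
    obtain ⟨k, rfl⟩ := exists_same hy
    simp only [transp]
    rw [← op_sbr, MulOpposite.op_eq_zero_iff]
    refine hS.uniq (hS.sbr _ _ (hF1 s hab) (hF1 r hab)) ?_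
    rw [tri_mk_F hab, tri_mk_F hab]
    simp only [pp_mk]
    rw [sbr_yF_yF a b hab _ _ _ _ _ _ (by omega) (by omega)]
    refine hS.sign_zero _ (hS.sub_zero (hS.sum_zero _ _ fun u hu => ?_)
      (hS.sum_zero _ _ fun u hu => ?_)) <;>
    · rw [Finset.mem_Ico] at hu
      exact hS.mul_lower (hFr hab _ _ _ (by omega)) (hFr hab _ _ _ (by omega)) (by omega)
  · rintro ⟨a, i⟩ ⟨b, j⟩ ⟨c, k⟩ r s hab hbc
    simp only [transp]
    rw [← op_sbr, ← op_sbr, MulOpposite.op_inj, sbr_swap, sbr_swap _ _ (t _ _ (s + 1))]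
    refine congrArg (fun g => -((-1) ^ _ * g)) ?_
    have h1 := hS.sbr (pp ⟨a, i⟩ + pp ⟨b, j⟩) (pp ⟨b, j⟩ + pp ⟨c, k⟩) (hF1 (r + 1) hab) (hF1 s hbc)
    have h2 := hS.sbr (pp ⟨a, i⟩ + pp ⟨b, j⟩) (pp ⟨b, j⟩ + pp ⟨c, k⟩) (hF1 r hab) (hF1 (s + 1) hbc)
    rw [show r + (s + 1) = r + 1 + s by omega] at h2
    refine sub_eq_zero.1 (hS.uniq (hS.sub h1 h2) ?_)
    rw [tri_mk_F hab, tri_mk_F hab, tri_mk_F hbc, tri_mk_F hbc]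
    simp only [pp_mk]
    rw [sbr_yF_yF_next a b c hab hbc _ _ _ _ _ _ (by omega) (by omega)]
    rw [if_pos rfl]
    refine hS.neg_zero (hS.sign_zero _ (hS.sum_zero _ _ fun u _ => ?_))
    exact hS.mul_lower (hFr hbc _ _ _ (by omega)) (hFr hab _ _ _ (by omega)) (by omega)
  · intro x y y' w r s hxy hy hyw hne
    have e := rootRel_transp_tri.ne r s hxy hy hyw hne
    simp only [transp] at e ⊢
    rw [← op_sbr, MulOpposite.op_eq_zero_iff] at e ⊢
    exact hS.eq_zero (hS.sbr _ _ (hF1 s hyw) (hF1 r hxy)) e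
  · intro x y z w r s hxy hzw hyz
    have e := rootRel_transp_tri.far r s hxy hzw hyz
    simp only [transp] at e ⊢
    rw [← op_sbr, MulOpposite.op_eq_zero_iff] at e ⊢
    exact hS.eq_zero (hS.sbr _ _ (hF1 s hzw) (hF1 r hxy)) e
  · rintro ⟨a, i⟩ ⟨b, j⟩ x' y' ⟨c, f⟩ ⟨d, g⟩ r s l hab hx hy hcd hne
    obtain ⟨h, rfl⟩ := exists_same hx
    obtain ⟨k, rfl⟩ := exists_same hy
    simp only [transp]
    -- Passing to the opposite ring has reversed the nested brackets. Turning them back costs signs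
    -- that are common to both summands and can be dropped.
    rw [← op_sbr, ← op_sbr, ← op_sbr, ← op_sbr, ← MulOpposite.op_add, MulOpposite.op_eq_zero_iff,
      sbr_swap _ _ (SuperYangian.sbr _ _ _ _), sbr_swap _ _ (SuperYangian.sbr _ _ _ (t _ _ r)),
      sbr_swap _ _ (t ⟨d, g⟩ ⟨c, f⟩ l), sbr_swap _ _ (t ⟨d, g⟩ ⟨c, f⟩ l) (t _ _ r),
      ← neg_add, ← mul_add, neg_eq_zero, sign_mul_eq_zero, sbr_neg_right, sbr_neg_right,
      sbr_sign_right, sbr_sign_right, ← neg_add, ← mul_add, neg_eq_zero, sign_mul_eq_zero]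
    have h1 := hS.sbr (pp ⟨a, i⟩ + pp ⟨b, j⟩) (pp ⟨a, h⟩ + pp ⟨b, k⟩ + (pp ⟨c, f⟩ + pp ⟨d, g⟩))
      (hF1 (y := ⟨a, i⟩) (x := ⟨b, j⟩) r hab) (hS.sbr (pp ⟨a, h⟩ + pp ⟨b, k⟩)
      (pp ⟨c, f⟩ + pp ⟨d, g⟩) (hF1 (y := ⟨a, h⟩) (x := ⟨b, k⟩) s hab) (hF1 l hcd))
    have h2 := hS.sbr (pp ⟨a, i⟩ + pp ⟨b, j⟩) (pp ⟨a, h⟩ + pp ⟨b, k⟩ + (pp ⟨c, f⟩ + pp ⟨d, g⟩))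
      (hF1 (y := ⟨a, i⟩) (x := ⟨b, j⟩) s hab) (hS.sbr (pp ⟨a, h⟩ + pp ⟨b, k⟩)
      (pp ⟨c, f⟩ + pp ⟨d, g⟩) (hF1 (y := ⟨a, h⟩) (x := ⟨b, k⟩) r hab) (hF1 l hcd))
    rw [show s + (r + l) = r + (s + l) by omega] at h2
    refine hS.eq_zero (hS.add h1 h2) ?_
    rw [tri_mk_F hab, tri_mk_F hab, tri_mk_F hab, tri_mk_F hab, tri_mk_F hcd]
    exact yF_serre a b c d hab hcd (fun e => hne (congrArg Fin.val e)) _ _ _ _ _ _ _ _ _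
      (by omega) (by omega) (by omega)
  · rintro ⟨a, i⟩ ⟨b, j⟩ ⟨c, k⟩ ⟨d, l⟩ r s hab hbc hcd hm
    simp only [transp]
    rw [← op_sbr, ← op_sbr, ← op_sbr, MulOpposite.op_eq_zero_iff]
    refine sbr_eq_zero_comm ?_
    rw [sbr_swap _ _ (t ⟨c, k⟩ ⟨b, j⟩ 0), sbr_swap _ _ (t ⟨d, l⟩ ⟨c, k⟩ s), sbr_neg_left,
      sbr_neg_right, sbr_sign_left, sbr_sign_right]
    refine neg_eq_zero.2 (neg_eq_zero.2 (sign_mul_eq_zero.2 (sign_mul_eq_zero.2 ?_)))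
    refine hS.eq_zero (hS.sbr _ _ (hS.sbr _ _ (hF1 r hab) (hF1 0 hbc))
      (hS.sbr _ _ (hF1 0 hbc) (hF1 s hcd))) ?_
    rw [tri_mk_F hab, tri_mk_F hbc, tri_mk_F hcd]
    exact yF_quartic a b c d hab hbc hcd (by simp only [blk] at *; omega) _ _ _ _ _ _ _ _ _ _
      (by omega) (by omega)

end Triangular


/-! ### The relations of the graded algebra -/

section

variable {m n : ℕ} {μ : Fin (m + n) → ℕ+} {G : Type*} {t : Pos μ → Pos μ → ℕ → G}
  {S : ℕ → Yhat μ → G → Prop}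

theorem tri_symbol_D (hT : ∀ x y r, S r (tri x y r) (t x y r)) {a : Fin (m + n)} (i j : Fin (μ a))
    (r : ℕ) : S r (yD a i j (r + 1)) (t ⟨a, i⟩ ⟨a, j⟩ r) := by
  rw [← tri_diag]; exact hT _ _ r

theorem tri_symbol_E (hT : ∀ x y r, S r (tri x y r) (t x y r)) {a b : Fin (m + n)}
    (hab : a.val + 1 = b.val) (i : Fin (μ a)) (j : Fin (μ b)) (r : ℕ) :
    S r (yE a b hab i j (r + 1)) (t ⟨a, i⟩ ⟨b, j⟩ r) := by
  rw [← tri_mk_E hab]; exact hT _ _ r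

theorem tri_symbol_F (hT : ∀ x y r, S r (tri x y r) (t x y r)) {a b : Fin (m + n)}
    (hab : a.val + 1 = b.val) (i : Fin (μ b)) (j : Fin (μ a)) (r : ℕ) :
    S r (yF a b hab i j (r + 1)) (t ⟨b, i⟩ ⟨a, j⟩ r) := by
  rw [← tri_mk_F hab]; exact hT _ _ r

theorem tri_symbol_D' (hT : ∀ x y r, S r (tri x y r) (t x y r)) {a : Fin (m + n)} (i j : Fin (μ a)) {r : ℕ} (hr : 1 ≤ r) :
    S (r - 1) (yD a i j r) (t ⟨a, i⟩ ⟨a, j⟩ (r - 1)) := by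
  obtain ⟨r, rfl⟩ := Nat.exists_eq_add_of_le' hr
  exact tri_symbol_D hT i j r

theorem tri_symbol_E' (hT : ∀ x y r, S r (tri x y r) (t x y r)) {a b : Fin (m + n)} (hab : a.val + 1 = b.val) (i : Fin (μ a)) (j : Fin (μ b)) {r : ℕ}
    (hr : 1 ≤ r) : S (r - 1) (yE a b hab i j r) (t ⟨a, i⟩ ⟨b, j⟩ (r - 1)) := by
  obtain ⟨r, rfl⟩ := Nat.exists_eq_add_of_le' hr
  exact tri_symbol_E hT hab i j r

theorem tri_symbol_F' (hT : ∀ x y r, S r (tri x y r) (t x y r)) {a b : Fin (m + n)} (hab : a.val + 1 = b.val) (i : Fin (μ b)) (j : Fin (μ a)) {r : ℕ}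
    (hr : 1 ≤ r) : S (r - 1) (yF a b hab i j r) (t ⟨b, i⟩ ⟨a, j⟩ (r - 1)) := by
  obtain ⟨r, rfl⟩ := Nat.exists_eq_add_of_le' hr
  exact tri_symbol_F hT hab i j r

end

section Graded

variable {m n : ℕ} {μ : Fin (m + n) → ℕ+} {G : Type*} [Ring G] {t : Pos μ → Pos μ → ℕ → G}
  {S : ℕ → Yhat μ → G → Prop}

theorem mk_inj_iff {a : Fin (m + n)} {i j : Fin (μ a)} :
    ((⟨a, i⟩ : Pos μ) = ⟨a, j⟩) ↔ i = j := by simp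

theorem mk_ne {a b : Fin (m + n)} (h : a ≠ b) (i : Fin (μ a)) (j : Fin (μ b)) :
    ((⟨a, i⟩ : Pos μ) = ⟨b, j⟩) ↔ False := by simp [h]

theorem yDinv_zero (a : Fin (m + n)) (i j : Fin (μ a)) :
    yDinv a i j 0 = if i = j then 1 else 0 := by
  simpa [yD_zero] using sum_yD_mul_yDinv a i j 0

/-- The two extreme summands of the inversion formula contain D^{(0)} = δ and D'^{(0)} = δ and
reduce to D' and D; solving for D' gives a recursion. -/
theorem yDinv_succ (a : Fin (m + n)) (i j : Fin (μ a)) (r : ℕ) :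
    yDinv a i j (r + 1) = -(∑ u ∈ Finset.range r, ∑ p : Fin (μ a),
      yD a i p (u + 1) * yDinv a p j (r - u)) - yD a i j (r + 1) := by
  have := sum_yD_mul_yDinv a i j (r + 1)
  rw [Finset.sum_range_succ, Finset.sum_range_succ'] at this
  simp only [yD_zero, yDinv_zero, Nat.sub_self, Nat.sub_zero, ite_mul, one_mul, zero_mul, mul_ite,
    mul_one, mul_zero, Finset.sum_ite_eq, Finset.sum_ite_eq', Finset.mem_univ, if_true,
    Nat.add_sub_add_right, Nat.succ_ne_zero, false_and, if_false] at this
  rw [← sub_eq_zero, ← this]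
  abel

theorem sign_cube (a b : ℕ) : (-1 : G) ^ (a * a + a * b + a * b) = (-1) ^ a := by
  have : a * a % 2 = a % 2 := by
    rcases Nat.mod_two_eq_zero_or_one a with h | h <;> simp [Nat.mul_mod, h]
  exact sign_congr (by omega)

theorem sign_cube' (a b : ℕ) : (-1 : G) ^ (a * b + a * b + b * b) = (-1) ^ b := by
  have : b * b % 2 = b % 2 := by
    rcases Nat.mod_two_eq_zero_or_one b with h | h <;> simp [Nat.mul_mod, h]
  exact sign_congr (by omega)

namespace Symbol

variable (hS : Symbol S) (hT : ∀ x y r, S r (tri x y r) (t x y r))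
include hS hT

/-- The products in the recursion have positive upper indices on both sides, so they lie below top
degree: the class of D' is minus the class of D. -/
theorem yDinv {a : Fin (m + n)} (i j : Fin (μ a)) {r : ℕ} (hr : 1 ≤ r) :
    S (r - 1) (yDinv a i j r) (-t ⟨a, i⟩ ⟨a, j⟩ (r - 1)) := by
  induction r using Nat.strong_induction_on generalizing i j with
  | _ r ih =>
    obtain ⟨r, rfl⟩ := Nat.exists_eq_add_of_le' hr
    rw [yDinv_succ, ← zero_sub (t _ _ _)]
    refine hS.sub (hS.neg_zero (hS.sum_zero _ _ fun u hu => hS.sum_zero _ _ fun p _ => ?_))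
      (tri_symbol_D' hT i j (by omega))
    rw [Finset.mem_range] at hu
    exact hS.mul_lower (tri_symbol_D' hT _ _ (by omega)) (ih (r - u) (by omega) _ _ (by omega)) (by omega)

/-- Only the summand t = 0 contains D^{(0)} = δ and reaches degree r + s; all others lie one degree
lower. The same count governs the brackets of `D` with `E` and `F`. -/
theorem comm_diag {x y z w : Pos μ} (hxy : blk x = blk y) (hzw : blk z = blk w) :
    Comm t x y z w := by
  obtain ⟨a, i⟩ := x
  obtain ⟨b, h⟩ := z
  obtain ⟨j, rfl⟩ := exists_same hxy.symm
  obtain ⟨k, rfl⟩ := exists_same hzw.symm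
  intro r s
  refine hS.uniq (hS.sbr _ _ (hT _ _ r) (hT _ _ s)) ?_
  rw [tri_diag, tri_diag]
  simp only [pp_mk]
  rw [sbr_congr (p' := 0) (q' := 0) (by omega) (by omega)]
  by_cases hab : a = b
  · subst hab
    rw [sbr_yD_yD, Nat.add_min_add_right, Finset.sum_range_succ', mul_add]
    refine hS.lower_add (hS.sign_zero _ (hS.sum_zero _ _ fun u hu => ?_)) ?_
    · rw [Finset.mem_range, lt_min_iff] at hu
      exact hS.sub_zero
        (hS.mul_lower (tri_symbol_D' hT _ _ (by omega)) (tri_symbol_D' hT _ _ (by omega)) (by omega))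
        (hS.mul_lower (tri_symbol_D' hT _ _ (by omega)) (tri_symbol_D' hT _ _ (by omega)) (by omega))
    · have e : r + 1 + (s + 1) - 1 - 0 = r + s + 1 := by omega
      simp only [e, yD_zero, mk_inj_iff, eq_comm (a := h)]
      rw [sign_cube, mul_sub]
      refine hS.sub ?_ ?_
      · split_ifs
        · rw [one_mul]; exact hS.sign _ (tri_symbol_D hT _ _ _)
        · rw [zero_mul, mul_zero]; exact hS.zero _
      · split_ifs
        · rw [mul_one]; exact hS.sign _ (tri_symbol_D hT _ _ _)
        · rw [mul_zero, mul_zero]; exact hS.zero _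
  · rw [sbr_yD_yD_ne a b hab]
    simp only [mk_ne hab, if_false, _root_.sub_zero]
    exact hS.zero _

theorem comm_diag_upper {x y z w : Pos μ} (hxy : blk x = blk y) (hzw : blk z + 1 = blk w) :
    Comm t x y z w := by
  obtain ⟨a, i⟩ := x
  obtain ⟨j, rfl⟩ := exists_same hxy.symm
  obtain ⟨b, h⟩ := z
  obtain ⟨c, k⟩ := w
  have hbc : b ≠ c := fun e => by subst e; simp [blk] at hzw
  intro r s
  refine hS.uniq (hS.sbr _ _ (hT _ _ r) (hT _ _ s)) ?_
  rw [tri_diag, tri_mk_E hzw]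
  simp only [pp_mk]
  rw [sbr_diag_congr]
  have e : r + 1 + (s + 1) - 1 - 0 = r + s + 1 := by omega
  by_cases hab : a = b
  · subst hab
    rw [sbr_yD_yE_left a c hzw _ _ _ _ _ _ (by omega), Finset.sum_range_succ']
    simp only [e, yD_zero, mk_inj_iff, eq_comm (a := h), mk_ne hbc, if_false, _root_.sub_zero,
      ite_mul, one_mul, zero_mul, Finset.sum_ite_eq, Finset.mem_univ, if_true]
    split_ifs
    · refine hS.sign _ ?_
      refine hS.lower_add (hS.sum_zero _ _ fun u hu => hS.sum_zero _ _ fun p _ => ?_)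
        (tri_symbol_E hT hzw _ _ _)
      rw [Finset.mem_range] at hu
      exact hS.mul_lower (tri_symbol_D' hT _ _ (by omega)) (tri_symbol_E' hT hzw _ _ (by omega)) (by omega)
    · rw [mul_zero]; exact hS.zero _
  by_cases hac : a = c
  · subst hac
    rw [sbr_yD_yE_right b a hzw _ _ _ _ _ _ (by omega), Finset.sum_range_succ']
    simp only [e, yD_zero, mk_inj_iff, mk_ne hab, if_false, zero_sub,
      ite_mul, one_mul, zero_mul]
    rw [sign_cube]
    refine hS.neg ?_
    rw [mul_add]
    refine hS.lower_add (hS.sign_zero _ (hS.sum_zero _ _ fun u hu => ?_)) ?_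
    · rw [Finset.mem_range] at hu
      exact hS.mul_lower (tri_symbol_D' hT _ _ (by omega)) (tri_symbol_E' hT hzw _ _ (by omega)) (by omega)
    · rw [← mul_ite_zero]
      exact hS.sign _ (hS.ite _ (tri_symbol_E hT hzw _ _ _))
  · rw [sbr_yD_yE_ne a b c hzw hab hac _ _ _ _ _ _ (by omega)]
    simp only [mk_ne hab, mk_ne hac, if_false, _root_.sub_zero]
    exact hS.zero _

theorem comm_diag_lower {x y z w : Pos μ} (hxy : blk x = blk y) (hzw : blk z = blk w + 1) :
    Comm t x y z w := by
  obtain ⟨a, i⟩ := x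
  obtain ⟨j, rfl⟩ := exists_same hxy.symm
  obtain ⟨c, h⟩ := z
  obtain ⟨b, k⟩ := w
  have hbc : b ≠ c := fun e => by subst e; simp [blk] at hzw
  intro r s
  refine hS.uniq (hS.sbr _ _ (hT _ _ r) (hT _ _ s)) ?_
  rw [tri_diag, tri_mk_F hzw.symm]
  simp only [pp_mk]
  rw [sbr_diag_congr, add_comm (par m c)]
  have e : r + 1 + (s + 1) - 1 - 0 = r + s + 1 := by omega
  by_cases hab : a = b
  · subst hab
    rw [sbr_yD_yF_left a c hzw.symm _ _ _ _ _ _ (by omega), Finset.sum_range_succ']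
    simp only [e, yD_zero, mk_inj_iff, eq_comm (a := k), mk_ne hbc, if_false, zero_sub,
      mul_ite, mul_one, mul_zero, Finset.sum_ite_eq', Finset.mem_univ, if_true]
    rw [sign_cube]
    refine hS.neg ?_
    split_ifs
    · refine hS.sign _ ?_
      refine hS.lower_add (hS.sum_zero _ _ fun u hu => hS.sum_zero _ _ fun p _ => ?_)
        (tri_symbol_F hT hzw.symm _ _ _)
      rw [Finset.mem_range] at hu
      exact hS.mul_lower (tri_symbol_F' hT hzw.symm _ _ (by omega)) (tri_symbol_D' hT _ _ (by omega)) (by omega)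
    · exact hS.zero _
  by_cases hac : a = c
  · subst hac
    rw [sbr_yD_yF_right b a hzw.symm _ _ _ _ _ _ (by omega), Finset.sum_range_succ']
    simp only [e, yD_zero, mk_inj_iff, mk_ne hab, if_false, _root_.sub_zero,
      mul_ite, mul_one, mul_zero, eq_comm (a := h)]
    rw [mul_add]
    refine hS.lower_add (hS.sign_zero _ (hS.sum_zero _ _ fun u hu => ?_)) ?_
    · rw [Finset.mem_range] at hu
      exact hS.mul_lower (tri_symbol_F' hT hzw.symm _ _ (by omega)) (tri_symbol_D' hT _ _ (by omega)) (by omega)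
    · rw [← mul_ite_zero]
      exact hS.sign _ (hS.ite _ (tri_symbol_F hT hzw.symm _ _ _))
  · rw [sbr_yD_yF_ne a b c hzw.symm hab hac _ _ _ _ _ _ (by omega)]
    simp only [mk_ne hab, mk_ne hac, if_false, _root_.sub_zero]
    exact hS.zero _

/-- Of the sum of products D D' only the two extreme summands reach top degree: they give the
diagonal element of the later block and, through D', minus that of the earlier block. -/
theorem comm_upper_lower {x y z w : Pos μ} (hxy : blk x + 1 = blk y) (hzw : blk z = blk w + 1) :
    Comm t x y z w := by
  obtain ⟨a, i⟩ := x
  obtain ⟨b, j⟩ := y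
  obtain ⟨d, h⟩ := z
  obtain ⟨c, k⟩ := w
  intro r s
  refine hS.uniq (hS.sbr _ _ (hT _ _ r) (hT _ _ s)) ?_
  rw [tri_mk_E hxy, tri_mk_F hzw.symm]
  simp only [pp_mk]
  rw [add_comm (par m d)]
  by_cases hac : a = c
  · subst hac
    obtain rfl : b = d := Fin.ext (by simp only [blk] at *; omega)
    rw [sbr_yE_yF a b hxy _ _ _ _ _ _ (by omega) (by omega),
      show r + 1 + (s + 1) = r + s + 1 + 1 by omega, Finset.sum_range_succ,
      Finset.sum_range_succ']
    have e : r + s + 1 + 1 - 1 = r + s + 1 := by omega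
    simp only [e, yD_zero, yDinv_zero, mk_inj_iff, Nat.sub_self, Nat.sub_zero, ite_mul, one_mul,
      zero_mul, mul_ite, mul_one, mul_zero, eq_comm (a := h)]
    rw [sign_cube']
    have key : S (r + s) ((∑ u ∈ Finset.range (r + s), SuperYangian.yD b h j (r + s + 1 - (u + 1)) *
        SuperYangian.yDinv a i k (u + 1) + if i = k then SuperYangian.yD b h j (r + s + 1) else 0) +
        if j = h then SuperYangian.yDinv a i k (r + s + 1) else 0)
        ((0 + if i = k then t ⟨b, h⟩ ⟨b, j⟩ (r + s) else 0) +
          if j = h then -t ⟨a, i⟩ ⟨a, k⟩ (r + s) else 0) := by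
      refine hS.add (hS.add (hS.sum_zero _ _ fun u hu => ?_)
        (hS.ite _ (tri_symbol_D hT _ _ _))) (hS.ite _ (hS.yDinv hT _ _ (r := r + s + 1) (by omega)))
      rw [Finset.mem_range] at hu
      exact hS.mul_lower (tri_symbol_D' hT _ _ (by omega)) (hS.yDinv hT _ _ (by omega)) (by omega)
    convert hS.neg (hS.sign (par m b) key) using 1
    split_ifs <;> simp; noncomm_ring
  · have hbd : b ≠ d := fun e => hac (Fin.ext (by subst e; simp only [blk] at *; omega))
    rw [sbr_yE_yF_ne a b c d hxy hzw.symm hac _ _ _ _ _ _ (by omega) (by omega)]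
    simp only [mk_ne hac, mk_ne hbd, if_false, _root_.sub_zero]
    exact hS.zero _

/-- The relations between the symbols of the elements `D`, `E`, `F`. -/
theorem fullRel (two : ∀ g : G, g + g = 0 → g = 0) : FullRel t where
  upper := hS.upperRel two fun r _ => hT _ _ r
  lower := hS.lowerRel two fun r _ => hT _ _ r
  diag := hS.comm_diag hT
  diag_upper := hS.comm_diag_upper hT
  diag_lower := hS.comm_diag_lower hT
  upper_lower := hS.comm_upper_lower hT

end Symbol

end Graded


/-! ### The associated graded algebras -/

section GrSymbol

variable {A : Type*} [Ring A] [Algebra ℂ A] {I : Type*} {x : I → A} {deg : I → ℕ}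

theorem fil_le_filLT {k l : ℕ} (h : k < l) : fil x deg k ≤ filLT x deg l :=
  Submodule.span_mono fun _ ⟨m, hm, e⟩ => ⟨m, hm.trans_lt h, e⟩

theorem filLT_le_fil (k : ℕ) : filLT x deg k ≤ fil x deg k :=
  Submodule.span_mono fun _ ⟨m, hm, e⟩ => ⟨m, hm.le, e⟩

theorem Gr.cls_eq_zero_iff {k : ℕ} {y : A} (hy : y ∈ fil x deg k) :
    Gr.cls x deg k y hy = 0 ↔ y ∈ filLT x deg k := by
  rw [Gr.cls, Ideal.Quotient.eq_zero_iff_mem]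
  refine ⟨fun h => by simpa using h k, fun h l => ?_⟩
  change (Polynomial.monomial k y).coeff l ∈ _
  rw [Polynomial.coeff_monomial]
  split_ifs with e
  · exact e ▸ h
  · exact Submodule.zero_mem _

theorem Gr.cls_add {k : ℕ} {y z : A} (hy : y ∈ fil x deg k) (hz : z ∈ fil x deg k) :
    Gr.cls x deg k (y + z) (Submodule.add_mem _ hy hz) =
      Gr.cls x deg k y hy + Gr.cls x deg k z hz := by
  rw [Gr.cls, Gr.cls, Gr.cls, ← map_add]
  exact congrArg _ (Subtype.ext (map_add _ y z))

theorem Gr.cls_neg {k : ℕ} {y : A} (hy : y ∈ fil x deg k) :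
    Gr.cls x deg k (-y) (Submodule.neg_mem _ hy) = -Gr.cls x deg k y hy := by
  rw [Gr.cls, Gr.cls, ← map_neg]
  exact congrArg _ (Subtype.ext (map_neg _ y))

theorem Gr.cls_mul {k l : ℕ} {y z : A} (hy : y ∈ fil x deg k) (hz : z ∈ fil x deg l) :
    Gr.cls x deg (k + l) (y * z) (fil_mul_fil hy hz) =
      Gr.cls x deg k y hy * Gr.cls x deg l z hz := by
  rw [Gr.cls, Gr.cls, Gr.cls, ← map_mul]
  exact congrArg _ (Subtype.ext (Polynomial.monomial_mul_monomial k l y z).symm)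

theorem Gr.two_torsion_free (g : Gr x deg) (h : g + g = 0) : g = 0 := by
  have e : algebraMap ℂ (rees x deg) (1 / 2) * (1 + 1) = 1 := by
    rw [← map_one (algebraMap ℂ (rees x deg)), ← map_add, ← map_mul]
    norm_num
  have e' := congrArg (Ideal.Quotient.mk (reesLT x deg)) e
  rw [map_mul, map_add, map_one] at e'
  rw [← one_mul g, ← e', mul_assoc, add_mul, one_mul, h, mul_zero]

variable (x deg) in
/-- The symbols for the filtration generated by a family of elements with degrees. -/
def grSymbol (k : ℕ) (a : A) (g : Gr x deg) : Prop :=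
  ∃ h : a ∈ fil x deg k, g = Gr.cls x deg k a h

theorem symbol_grSymbol : Symbol (grSymbol x deg) where
  zero k := ⟨Submodule.zero_mem _, ((Gr.cls_eq_zero_iff _).2 (Submodule.zero_mem _)).symm⟩
  add := by
    rintro k a b _ _ ⟨ha, rfl⟩ ⟨hb, rfl⟩
    exact ⟨_, (Gr.cls_add ha hb).symm⟩
  neg := by
    rintro k a _ ⟨ha, rfl⟩
    exact ⟨_, (Gr.cls_neg ha).symm⟩
  mul := by
    rintro k l a b _ _ ⟨ha, rfl⟩ ⟨hb, rfl⟩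
    exact ⟨_, (Gr.cls_mul ha hb).symm⟩
  lower := by
    rintro k l a _ ⟨ha, rfl⟩ hkl
    have h := fil_le_filLT hkl ha
    exact ⟨filLT_le_fil _ h, ((Gr.cls_eq_zero_iff _).2 h).symm⟩
  uniq := by
    rintro k a _ _ ⟨ha, rfl⟩ ⟨hb, rfl⟩
    rfl

theorem grSymbol_zero {k : ℕ} {a : A} (h : grSymbol x deg k a 0) : a ∈ filLT x deg k := by
  obtain ⟨ha, e⟩ := h
  exact (Gr.cls_eq_zero_iff ha).1 e.symm

/-- The defining relations live in `Yhat`, whereas the filtration of `Yplus` is intrinsic to the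
subalgebra. Along an injective map the symbols of the subalgebra become a partial symbol relation on
the ambient ring. -/
theorem Symbol.map {A B G : Type*} [Ring A] [Ring B] [Ring G] {S : ℕ → B → G → Prop}
    (hS : Symbol S) (f : B →+* A) (hf : Function.Injective f) :
    Symbol fun k a g => ∃ b, f b = a ∧ S k b g where
  zero k := ⟨0, map_zero f, hS.zero k⟩
  add := by
    rintro k _ _ g h ⟨a, rfl, ha⟩ ⟨b, rfl, hb⟩
    exact ⟨a + b, map_add f a b, hS.add ha hb⟩
  neg := by
    rintro k _ g ⟨a, rfl, ha⟩
    exact ⟨-a, map_neg f a, hS.neg ha⟩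
  mul := by
    rintro k l _ _ g h ⟨a, rfl, ha⟩ ⟨b, rfl, hb⟩
    exact ⟨a * b, map_mul f a b, hS.mul ha hb⟩
  lower := by
    rintro k l _ g ⟨a, rfl, ha⟩ hkl
    exact ⟨a, rfl, hS.lower ha hkl⟩
  uniq := by
    rintro k _ g h ⟨a, rfl, ha⟩ ⟨b, hb, hb'⟩
    exact hS.uniq ha (hf hb ▸ hb')

end GrSymbol

/-! ### The root elements in the graded algebras of `Yhat` and `Yplus` -/

section Loop

variable {m n : ℕ} {μ : Fin (m + n) → ℕ+}

/-- The row position of a root element. -/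
def Root.src : Root μ → Pos μ
  | .D a i _ _ => ⟨a, i⟩
  | .E a _ _ i _ _ => ⟨a, i⟩
  | .F _ b _ i _ _ => ⟨b, i⟩

/-- The column position of a root element. -/
def Root.tgt : Root μ → Pos μ
  | .D a _ j _ => ⟨a, j⟩
  | .E _ b _ _ j _ => ⟨b, j⟩
  | .F a _ _ _ j _ => ⟨a, j⟩

theorem Root.elt_eq_tri (X : Root μ) : X.elt = tri X.src X.tgt X.deg := by
  cases X with
  | D a i j r => exact (tri_diag a i j r).symm
  | E a b hab i j r => exact (tri_upper (x := ⟨a, i⟩) (y := ⟨b, j⟩) hab r).symm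
  | F a b hab i j r => exact (tri_lower (x := ⟨b, i⟩) (y := ⟨a, j⟩) hab r).symm

theorem Root.isOdd_iff (X : Root μ) : X.IsOdd ↔ Odd (pp X.src + pp X.tgt) := by
  cases X with
  | D a i j r => simp [Root.IsOdd, Root.src, Root.tgt, pp_mk]
  | E a b hab i j r => rfl
  | F a b hab i j r => simp only [Root.IsOdd, Root.src, Root.tgt, pp_mk, add_comm]

theorem exists_root (x y : Pos μ) (r : ℕ) : ∃ X : Root μ, X.elt = tri x y r ∧ X.deg = r := by
  obtain ⟨a, i⟩ := x
  obtain ⟨b, j⟩ := y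
  rcases lt_trichotomy a b with h | h | h
  · exact ⟨.E a b h i j r, (tri_upper (x := ⟨a, i⟩) (y := ⟨b, j⟩) h r).symm, rfl⟩
  · subst h
    exact ⟨.D a i j r, (tri_diag a i j r).symm, rfl⟩
  · exact ⟨.F b a h i j r, (tri_lower (x := ⟨a, i⟩) (y := ⟨b, j⟩) h r).symm, rfl⟩

theorem tri_mem_fil (x y : Pos μ) (r : ℕ) : tri x y r ∈ fil (Root.elt (μ := μ)) Root.deg r := by
  obtain ⟨X, hX, hr⟩ := exists_root x y r
  rw [← hX, ← hr]
  exact gen_mem_fil _ _ X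

/-- The classes of the root elements in the graded algebra of `Yhat`. -/
def triBar (x y : Pos μ) (r : ℕ) : GrYhat μ := Gr.cls Root.elt Root.deg r (tri x y r) (tri_mem_fil x y r)

theorem grSymbol_tri (x y : Pos μ) (r : ℕ) :
    grSymbol (Root.elt (μ := μ)) Root.deg r (tri x y r) (triBar x y r) := ⟨tri_mem_fil x y r, rfl⟩

/-- The commutation relations of all root elements in the graded algebra of `Yhat`. -/
theorem comm_triBar (x y z w : Pos μ) : Comm triBar x y z w :=
  (symbol_grSymbol.fullRel grSymbol_tri Gr.two_torsion_free).comm x y z w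

theorem ebar_eq_triBar (a b : Fin (m + n)) (hab : a < b) (i : Fin (μ a)) (j : Fin (μ b)) (r : ℕ) :
    ebar a b hab i j r = triBar ⟨a, i⟩ ⟨b, j⟩ r :=
  symbol_grSymbol.uniq ⟨_, rfl⟩
    ((tri_upper (x := ⟨a, i⟩) (y := ⟨b, j⟩) hab r) ▸ grSymbol_tri ⟨a, i⟩ ⟨b, j⟩ r)

/-- The classes of the elements `E` in the graded algebra of `Yplus`, extended by zero. -/
def upperBar (x y : Pos μ) (r : ℕ) : GrYplus μ :=
  if h : x.1 < y.1 then ebarPlus x.1 y.1 h x.2 y.2 r else 0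

theorem ebarPlus_eq_upperBar (a b : Fin (m + n)) (hab : a < b) (i : Fin (μ a)) (j : Fin (μ b))
    (r : ℕ) : ebarPlus a b hab i j r = upperBar ⟨a, i⟩ ⟨b, j⟩ r := by
  simp [upperBar, hab]

/-- The relations between the `E`'s involve no other generators, so `Symbol.upperRel` applies to the
symbols of `Yplus` carried along the inclusion into `Yhat`. -/
theorem comm_upperBar {x y z w : Pos μ} (hxy : blk x < blk y) (hzw : blk z < blk w) :
    Comm upperBar x y z w := by
  have hS : Symbol (grSymbol (EIdx.elt (μ := μ)) EIdx.r) := symbol_grSymbol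
  have hM := hS.map (Yplus μ).subtype Subtype.val_injective
  refine (hM.upperRel Gr.two_torsion_free fun {x y} r h => ?_).comm hxy hzw
  have h' : x.1 < y.1 := h
  rw [tri_upper h', upperBar, dif_pos h']
  exact ⟨EIdx.elt ⟨x.1, y.1, h', x.2, y.2, r⟩, rfl, _, rfl⟩

/-- Equality of positions means equal blocks and equal indices inside them. The equality of blocks
also supplies the inequality needed to form the root element on the right. -/
theorem Comm.graded_bracket {G : Type*} [Ring G] {t : Pos μ → Pos μ → ℕ → G}
    {e : ∀ (a b : Fin (m + n)), a < b → Fin (μ a) → Fin (μ b) → ℕ → G}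
    (he : ∀ a b hab i j r, e a b hab i j r = t ⟨a, i⟩ ⟨b, j⟩ r)
    {a b c d : Fin (m + n)} (hab : a < b) (hcd : c < d) {i : Fin (μ a)} {j : Fin (μ b)}
    {h : Fin (μ c)} {k : Fin (μ d)} (hc : Comm t ⟨a, i⟩ ⟨b, j⟩ ⟨c, h⟩ ⟨d, k⟩) (r s : ℕ) :
    sbr (par m a + par m b) (par m c + par m d) (e a b hab i j r) (e c d hcd h k s) =
        (-1) ^ par m b *
          (if H : b = c ∧ h.val = j.val then
            e a d (hab.trans (H.1 ▸ hcd)) i k (r + s) else 0)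
        - (-1) ^ (par m a * par m b + par m a * par m c + par m b * par m c) *
          (if H : a = d ∧ i.val = k.val then
            e c b (hcd.trans (H.1 ▸ hab)) h j (r + s) else 0) := by
  simp only [he]
  refine (hc r s).trans ?_
  simp only [pp_mk]
  congr 1
  · by_cases H : b = c ∧ h.val = j.val
    · obtain ⟨rfl, H⟩ := H
      obtain rfl := Fin.ext H
      simp
    · rw [dif_neg H, if_neg, mul_zero]
      intro e
      cases e
      exact H ⟨rfl, rfl⟩
  · by_cases H : a = d ∧ i.val = k.val
    · obtain ⟨rfl, H⟩ := H
      obtain rfl := Fin.ext H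
      simp
    · rw [dif_neg H, if_neg, mul_zero]
      intro e
      cases e
      exact H ⟨rfl, rfl⟩

end Loop


/-! ### Ordered monomials -/

section Ordered

variable {m n : ℕ} {μ : Fin (m + n) → ℕ+}

/-- The total degree of a monomial. -/
def totDeg (l : List (Root μ)) : ℕ := (l.map Root.deg).sum

/-- A monomial in the root elements. -/
def monom (l : List (Root μ)) : Yhat μ := (l.map Root.elt).prod

@[simp] theorem totDeg_cons (X : Root μ) (l : List (Root μ)) :
    totDeg (X :: l) = X.deg + totDeg l := by simp [totDeg]

@[simp] theorem monom_cons (X : Root μ) (l : List (Root μ)) :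
    monom (X :: l) = X.elt * monom l := by simp [monom]

variable (μ) in
/-- The span of the monomials which have degree less than `d`, or have degree `d` and less than `k`
factors. -/
def smaller (d k : ℕ) : Submodule ℂ (Yhat μ) :=
  Submodule.span ℂ {y | ∃ l : List (Root μ),
    (totDeg l < d ∨ totDeg l = d ∧ l.length < k) ∧ y = monom l}

theorem monom_mem_smaller {d k : ℕ} {l : List (Root μ)}
    (h : totDeg l < d ∨ totDeg l = d ∧ l.length < k) : monom l ∈ smaller μ d k :=
  Submodule.subset_span ⟨l, h, rfl⟩

theorem filLT_le_smaller (d k : ℕ) : filLT (Root.elt (μ := μ)) Root.deg d ≤ smaller μ d k := by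
  refine Submodule.span_le.2 ?_
  rintro _ ⟨l, hl, rfl⟩
  exact monom_mem_smaller (Or.inl hl)

theorem elt_mul_mem_smaller (X : Root μ) {d k : ℕ} {y : Yhat μ} (hy : y ∈ smaller μ d k) :
    X.elt * y ∈ smaller μ (X.deg + d) (k + 1) := by
  induction hy using Submodule.span_induction with
  | mem y h =>
    obtain ⟨l, hl, rfl⟩ := h
    rw [← monom_cons]
    refine monom_mem_smaller ?_
    rw [totDeg_cons, List.length_cons]
    omega
  | zero => simp
  | add y z _ _ hy hz => rw [mul_add]; exact Submodule.add_mem _ hy hz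
  | smul c y _ hy => rw [mul_smul_comm]; exact Submodule.smul_mem _ c hy

theorem sign_mul_mem {A : Type*} [Ring A] [Algebra ℂ A] {p : Submodule ℂ A} {y : A} (e : ℕ)
    (hy : y ∈ p) : (-1) ^ e * y ∈ p := by
  rcases sign_cases (A := A) e with h | h
  · simpa [h] using hy
  · simpa [h] using hy

/-- In the graded algebra the supercommutator of two root elements is a linear combination of root
elements. -/
theorem sbr_elt_mul_monom_mem (X Y : Root μ) (l : List (Root μ)) :
    sbr (pp X.src + pp X.tgt) (pp Y.src + pp Y.tgt) X.elt Y.elt * monom l ∈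
      smaller μ (X.deg + Y.deg + totDeg l) (l.length + 2) := by
  have hS := symbol_grSymbol (x := Root.elt (μ := μ)) (deg := Root.deg)
  have h1 := hS.sbr (pp X.src + pp X.tgt) (pp Y.src + pp Y.tgt)
    (grSymbol_tri X.src X.tgt X.deg) (grSymbol_tri Y.src Y.tgt Y.deg)
  rw [comm_triBar] at h1
  have h2 := hS.sub
    (hS.ite (X.tgt = Y.src) (hS.sign (pp X.tgt) (grSymbol_tri X.src Y.tgt (X.deg + Y.deg))))
    (hS.ite (X.src = Y.tgt) (hS.sign (pp X.src * pp X.tgt + pp X.src * pp Y.src +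
      pp X.tgt * pp Y.src) (grSymbol_tri Y.src X.tgt (X.deg + Y.deg))))
  have h3 := hS.sub h1 h2
  rw [sub_self, ← Root.elt_eq_tri, ← Root.elt_eq_tri] at h3
  -- The bracket minus its linear part has class zero, so the difference lies in lower degree.
  have h4 := grSymbol_zero h3
  have hl : monom l ∈ fil (Root.elt (μ := μ)) Root.deg (totDeg l) :=
    Submodule.subset_span ⟨l, le_rfl, rfl⟩
  have h5 := filLT_le_smaller _ (l.length + 2) (filLT_mul_fil h4 hl)
  -- In the linear part a single factor of the same degree replaces two, so the length drops from
  -- `l.length + 2` to `l.length + 1`.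
  have key : ∀ (c : Prop) [Decidable c] (e : ℕ) (x y : Pos μ),
      (if c then (-1) ^ e * tri x y (X.deg + Y.deg) else 0) * monom l ∈
        smaller μ (X.deg + Y.deg + totDeg l) (l.length + 2) := by
    intro c _ e x y
    split_ifs
    · obtain ⟨Z, hZ, hd⟩ := exists_root x y (X.deg + Y.deg)
      rw [← hZ, mul_assoc, ← monom_cons]
      refine sign_mul_mem e (monom_mem_smaller (Or.inr ⟨?_, ?_⟩))
      · rw [totDeg_cons, hd]
      · rw [List.length_cons]; omega
    · rw [zero_mul]; exact Submodule.zero_mem _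
  have h6 := Submodule.add_mem _ h5 (Submodule.sub_mem _
    (key (X.tgt = Y.src) (pp X.tgt) X.src Y.tgt)
    (key (X.src = Y.tgt) (pp X.src * pp X.tgt + pp X.src * pp Y.src + pp X.tgt * pp Y.src)
      Y.src X.tgt))
  rwa [← sub_mul, ← add_mul, sub_add_cancel] at h6

theorem totDeg_perm {l l' : List (Root μ)} (h : l.Perm l') : totDeg l = totDeg l' :=
  (h.map Root.deg).sum_eq

/-- Up to a sign and smaller monomials, the factors of a monomial may be permuted. -/
theorem monom_perm {l l' : List (Root μ)} (h : l.Perm l') :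
    ∃ e : ℕ, monom l - (-1) ^ e * monom l' ∈ smaller μ (totDeg l) l.length := by
  induction h with
  | nil => exact ⟨0, by simp⟩
  | @cons X l l' h ih =>
    obtain ⟨e, he⟩ := ih
    refine ⟨e, ?_⟩
    have := elt_mul_mem_smaller X he
    rw [monom_cons, monom_cons, totDeg_cons, List.length_cons]
    rwa [mul_sub_sign] at this
  | swap X Y l =>
    refine ⟨(pp Y.src + pp Y.tgt) * (pp X.src + pp X.tgt), ?_⟩
    have := sbr_elt_mul_monom_mem Y X l
    rw [sbr, sub_mul, mul_assoc, mul_assoc, mul_assoc] at this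
    simpa only [monom_cons, totDeg_cons, List.length_cons, add_assoc] using this
  | @trans l₁ l₂ l₃ h12 h23 ih1 ih2 =>
    obtain ⟨e, he⟩ := ih1
    obtain ⟨f, hf⟩ := ih2
    rw [← totDeg_perm h12, ← h12.length_eq] at hf
    refine ⟨e + f, ?_⟩
    have := Submodule.add_mem _ he (sign_mul_mem e hf)
    rwa [mul_sub, sub_add_sub_cancel, ← mul_assoc, ← pow_add] at this

/-- A monomial with a repeated odd factor is a combination of smaller ones. -/
theorem monom_sq_mem {X : Root μ} (hX : X.IsOdd) (u v : List (Root μ)) :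
    monom (u ++ X :: X :: v) ∈
      smaller μ (totDeg (u ++ X :: X :: v)) (u ++ X :: X :: v).length := by
  induction u with
  | nil =>
    have := sbr_elt_mul_monom_mem X X v
    have hodd := (X.isOdd_iff).1 hX
    -- For odd X the bracket [X, X] is 2X², and 2 is invertible in ℂ.
    rw [sbr_self hodd, ← two_smul ℂ (X.elt * X.elt), smul_mul_assoc] at this
    have h2 := Submodule.smul_mem _ (2⁻¹ : ℂ) this
    rw [smul_smul, inv_mul_cancel₀ two_ne_zero, one_smul, mul_assoc] at h2
    simpa only [List.nil_append, monom_cons, totDeg_cons, List.length_cons, add_assoc] using h2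
  | cons Y u ih =>
    simpa only [List.cons_append, monom_cons, totDeg_cons, List.length_cons] using
      elt_mul_mem_smaller Y ih

/-- In a sorted list equal entries are adjacent, so the only obstruction to being ordered is an odd
element next to itself. -/
theorem isOrdered_or_repeated (ord : LinearOrder (Root μ)) (l : List (Root μ))
    (h : l.Pairwise ord.le) :
    IsOrdered ord l ∨ ∃ (X : Root μ) (u v : List (Root μ)), X.IsOdd ∧ l = u ++ X :: X :: v := by
  induction l with
  | nil => exact Or.inl List.Pairwise.nil
  | cons a l ih =>
    rw [List.pairwise_cons] at h
    rcases ih h.2 with h1 | ⟨X, u, v, hX, rfl⟩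
    · by_cases hc : ∀ y ∈ l, ord.lt a y ∨ (a = y ∧ ¬ a.IsOdd)
      · exact Or.inl (List.pairwise_cons.2 ⟨hc, h1⟩)
      · push Not at hc
        obtain ⟨y, hy, hlt, hodd⟩ := hc
        have hay : a = y := ord.le_antisymm _ _ (h.1 y hy) hlt
        subst hay
        refine Or.inr ⟨a, [], l.tail, hodd rfl, ?_⟩
        cases l with
        | nil => simp at hy
        | cons b l =>
          have hab : a = b := by
            rcases List.mem_cons.1 hy with h' | h'
            · exact h'
            · exact ord.le_antisymm _ _ (h.1 b (by simp)) ((List.pairwise_cons.1 h.2).1 a h')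
          simp [hab]
    · exact Or.inr ⟨X, a :: u, v, hX, rfl⟩

/-- Lexicographic induction on degree and length. The two are nested because monomials of lower
degree produced by a bracket may be arbitrarily long. -/
theorem monom_mem_span_ordered (ord : LinearOrder (Root μ)) (l : List (Root μ)) :
    monom l ∈ Submodule.span ℂ {y : Yhat μ | ∃ l : List (Root μ), IsOrdered ord l ∧
      y = (l.map Root.elt).prod} := by
  set O := Submodule.span ℂ {y : Yhat μ | ∃ l : List (Root μ), IsOrdered ord l ∧
      y = (l.map Root.elt).prod} with hO
  suffices ∀ d k, ∀ l : List (Root μ), totDeg l = d → l.length = k → monom l ∈ O from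
    this _ _ l rfl rfl
  intro d
  induction d using Nat.strong_induction_on with
  | _ d ihd =>
    intro k
    induction k using Nat.strong_induction_on with
    | _ k ihk =>
      intro l hd hk
      have hsmall : smaller μ d k ≤ O := by
        refine Submodule.span_le.2 ?_
        rintro _ ⟨l', h | ⟨h, h'⟩, rfl⟩
        · exact ihd _ h _ l' rfl rfl
        · exact ihk _ h' l' h rfl
      -- Sorting changes the monomial by a sign and smaller monomials. The sorted monomial is either
      -- admissible or contains an odd square, which is itself a combination of smaller ones.
      have hperm := List.perm_insertionSort (r := ord.le) l
      have hsorted : (l.insertionSort ord.le).Pairwise ord.le := List.pairwise_insertionSort _ l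
      have hmem : monom (l.insertionSort ord.le) ∈ O := by
        rcases isOrdered_or_repeated ord _ hsorted with h | ⟨X, u, v, hX, e⟩
        · exact Submodule.subset_span ⟨_, h, rfl⟩
        · have := monom_sq_mem hX u v
          rw [← e, totDeg_perm hperm, hperm.length_eq, hd, hk] at this
          exact hsmall this
      obtain ⟨e, he⟩ := monom_perm hperm.symm
      rw [hd, hk] at he
      have := Submodule.add_mem _ (hsmall he) (sign_mul_mem e hmem)
      rwa [sub_add_cancel] at this

/-- The generators not among the root elements are D^{(0)}, which is constant, and D', which is a
polynomial in the `D`'s by the recursion `yDinv_succ`. -/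
theorem adjoin_elt : Algebra.adjoin ℂ (Set.range (Root.elt (μ := μ))) = ⊤ := by
  set B := Algebra.adjoin ℂ (Set.range (Root.elt (μ := μ))) with hB
  have helt : ∀ X : Root μ, X.elt ∈ B := fun X => Algebra.subset_adjoin ⟨X, rfl⟩
  have htri : ∀ (x y : Pos μ) r, tri x y r ∈ B := by
    intro x y r
    obtain ⟨X, hX, -⟩ := exists_root x y r
    exact hX ▸ helt X
  have hD : ∀ (a : Fin (m + n)) (i j : Fin (μ a)) r, yD a i j r ∈ B := by
    intro a i j r
    cases r with
    | zero =>
      rw [yD_zero]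
      split_ifs
      · exact B.one_mem
      · exact B.zero_mem
    | succ r => rw [← tri_diag]; exact htri _ _ _
  have hDinv : ∀ (a : Fin (m + n)) (i j : Fin (μ a)) r, yDinv a i j r ∈ B := by
    intro a i j r
    induction r using Nat.strong_induction_on generalizing i j with
    | _ r ih =>
      cases r with
      | zero =>
        rw [yDinv_zero]
        split_ifs
        · exact B.one_mem
        · exact B.zero_mem
      | succ r =>
        rw [yDinv_succ]
        refine B.sub_mem (B.neg_mem (B.sum_mem fun u hu => B.sum_mem fun p _ => ?_)) (hD _ _ _ _)
        exact B.mul_mem (hD _ _ _ _) (ih _ (by omega) _ _)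
  refine (Algebra.eq_top_iff).2 fun y => ?_
  obtain ⟨y, rfl⟩ := RingQuot.mkAlgHom_surjective ℂ (Rel μ) y
  change toYhat μ y ∈ B
  induction y using FreeAlgebra.induction with
  | grade0 c => rw [AlgHom.commutes]; exact B.algebraMap_mem c
  | grade1 g =>
    cases g with
    | D a i j r => exact hD a i j r
    | Dinv a i j r => exact hDinv a i j r
    | E a b hab i j r =>
      have := htri ⟨a, i⟩ ⟨b, j⟩ r
      rwa [tri_mk_E hab] at this
    | F a b hab i j r =>
      have := htri ⟨b, i⟩ ⟨a, j⟩ r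
      rwa [tri_mk_F hab] at this
  | mul x y hx hy => rw [map_mul]; exact B.mul_mem hx hy
  | add x y hx hy => rw [map_add]; exact B.add_mem hx hy

/-- The ordered monomials span, for every order. -/
theorem span_ordered (ord : LinearOrder (Root μ)) :
    Submodule.span ℂ {y : Yhat μ | ∃ l : List (Root μ), IsOrdered ord l ∧
      y = (l.map Root.elt).prod} = ⊤ := by
  have h : Subalgebra.toSubmodule (Algebra.adjoin ℂ (Set.range (Root.elt (μ := μ)))) = ⊤ := by
    rw [adjoin_elt]; rfl
  rw [Algebra.adjoin_eq_span] at h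
  rw [← top_le_iff, ← h, Submodule.span_le]
  intro y hy
  obtain ⟨l, hl, rfl⟩ := Submonoid.exists_list_of_mem_closure hy
  obtain ⟨l, rfl⟩ := Set.range_list_map (Root.elt (μ := μ)) ▸ (show l ∈ {l | ∀ x ∈ l, x ∈ Set.range (Root.elt (μ := μ))} from hl)
  exact monom_mem_span_ordered ord l

end Ordered

end SuperYangian

end

open SuperYangian in
theorem proposition8p1 {m n : ℕ} (μ : Fin (m + n) → ℕ+) :
    -- `E_{a,c;i,j}^{(r)}` and `F_{c,a;i,j}^{(r)}` do not depend on the index `k` of block `b = c - 1`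
    (∀ (a b c : Fin (m + n)) (hab : a < b) (hbc : b.val + 1 = c.val) (hac : a < c)
        (i : Fin (μ a)) (j : Fin (μ c)) (k : Fin (μ b)) (r : ℕ), 1 ≤ r →
      rootE a c hac i j r = (-1) ^ par m b *
          sbr (par m a + par m b) (par m b + par m c) (rootE a b hab i k r) (yE b c hbc k j 1) ∧
      rootF a c hac j i r = (-1) ^ par m b *
          sbr (par m b + par m c) (par m a + par m b) (yF b c hbc j k 1) (rootF a b hab k i r)) ∧
    -- the ordered monomials span, for every choice of the order
    (∀ ord : LinearOrder (Root μ),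
      Submodule.span ℂ {y : Yhat μ | ∃ l : List (Root μ), IsOrdered ord l ∧
        y = (l.map Root.elt).prod} = ⊤) ∧
    -- the bracket in the graded algebra of `Yplus`; `r`, `s` are the upper indices minus one
    (∀ (a b c d : Fin (m + n)) (hab : a < b) (hcd : c < d) (i : Fin (μ a)) (j : Fin (μ b))
        (h : Fin (μ c)) (k : Fin (μ d)) (r s : ℕ),
      sbr (par m a + par m b) (par m c + par m d) (ebarPlus a b hab i j r) (ebarPlus c d hcd h k s) =
        (-1) ^ par m b *
          (if H : b = c ∧ h.val = j.val then
            ebarPlus a d (hab.trans (H.1 ▸ hcd)) i k (r + s) else 0)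
        - (-1) ^ (par m a * par m b + par m a * par m c + par m b * par m c) *
          (if H : a = d ∧ i.val = k.val then
            ebarPlus c b (hcd.trans (H.1 ▸ hab)) h j (r + s) else 0)) ∧
    -- the same formula in the graded algebra of `Yhat`
    (∀ (a b c d : Fin (m + n)) (hab : a < b) (hcd : c < d) (i : Fin (μ a)) (j : Fin (μ b))
        (h : Fin (μ c)) (k : Fin (μ d)) (r s : ℕ),
      sbr (par m a + par m b) (par m c + par m d) (ebar a b hab i j r) (ebar c d hcd h k s) =
        (-1) ^ par m b *
          (if H : b = c ∧ h.val = j.val then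
            ebar a d (hab.trans (H.1 ▸ hcd)) i k (r + s) else 0)
        - (-1) ^ (par m a * par m b + par m a * par m c + par m b * par m c) *
          (if H : a = d ∧ i.val = k.val then
            ebar c b (hcd.trans (H.1 ▸ hab)) h j (r + s) else 0)) := by
  refine ⟨fun a b c hab hbc hac i j k r hr => ?_, span_ordered, ?_, ?_⟩
  · obtain ⟨r, rfl⟩ := Nat.exists_eq_add_of_le' hr
    have hE := (rootRel_tri (μ := μ)).split (x := ⟨a, i⟩) (y := ⟨b, k⟩) (w := ⟨c, j⟩) hab hbc r
    have hF := (rootRel_transp_tri (μ := μ)).split (x := ⟨a, i⟩) (y := ⟨b, k⟩) (w := ⟨c, j⟩)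
      hab hbc r
    -- The statement for `F` is the one proved in the opposite ring, read back through `op`.
    simp only [transp] at hF
    rw [← op_sbr, ← op_sign_mul, MulOpposite.op_inj, tri_lower (x := ⟨c, j⟩) (y := ⟨a, i⟩) hac,
      tri_lower (x := ⟨b, k⟩) (y := ⟨a, i⟩) hab, tri_mk_F hbc] at hF
    rw [tri_upper (x := ⟨a, i⟩) (y := ⟨c, j⟩) hac, tri_upper (x := ⟨a, i⟩) (y := ⟨b, k⟩) hab,
      tri_mk_E hbc] at hE
    exact ⟨hE, hF⟩
  · intro a b c d hab hcd i j h k r s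
    exact Comm.graded_bracket (t := upperBar) (e := ebarPlus) ebarPlus_eq_upperBar hab hcd
      (comm_upperBar hab hcd) r s
  · intro a b c d hab hcd i j h k r s
    exact Comm.graded_bracket (t := triBar) (e := ebar) ebar_eq_triBar hab hcd
      (comm_triBar _ _ _ _) r s
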